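/- Let $\Bbbk=\mathbb{R}$ or $\mathbb{C}$, let $m,n\ge 0$, let $\pi\subset\{1,\dots,m\}$ with $\sharp\pi=k$, and let $\pi^c=\{1,\dots,m\}\setminus\pi$. For $A\in\Bbbk^{m\times n}$ of rank $r$, let $\sigma_1\ge\dots\ge\sigma_r>0$ be its positive singular values and put $\sigma_{r+1}=\dots=\sigma_m=0$. A full singular value decomposition of $A$ is a factorization $A=U\widehat\Sigma V^H$ with $U\in\Bbbk^{m\times m}$ and $V\in\Bbbk^{n\times n}$ unitary and $\widehat\Sigma\in\mathbb{R}^{m\times n}$ zero except for the singular values, in decreasing order, on its diagonal. Let $\mathrm{U}_\pi$ be the span of the columns of $U$ at the positions in $\pi$. For $s\ge0$ let $\mathrm{U}_s$ be the eigenspace of $AA^H$ for the eigenvalue $s^2$. The left singular subspaces of $A$ are the sums $\bigoplus_{s\in S}\mathrm{U}_s$ with $S\subset\{\sigma_1,\dots,\sigma_r,0\}$. Let $\mathcal{U}_\pi$ be the set of all $A\in\Bbbk^{m\times n}$ for which $\mathrm{U}_\pi$ is a left singular subspace of $A$; for these $A$ the subspace $\mathrm{U}_\pi$ does not depend on the chosen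 decomposition. Let $\mathrm{Gr}(k,\Bbbk^m)=\{QQ^H : Q\in\Bbbk^{m\times k},\ Q^HQ=I_k\}$ be the Grassmannian of $k$-dimensional subspaces of $\Bbbk^m$, each identified with the orthogonal projector onto it, and let $\mathcal{L}_\pi:\mathcal{U}_\pi\to\mathrm{Gr}(k,\Bbbk^m)$, $A\mapsto\mathrm{U}_\pi$. Measure distances in $\mathcal{U}_\pi$ by the Frobenius distance $\|A-A'\|_F$. Measure distances in $\mathrm{Gr}(k,\Bbbk^m)$ by any one of the chordal distance $\|\sin\boldsymbol\theta\|$, the Grassmann distance $\|\boldsymbol\theta\|$ and the Procrustes distance $\|2\sin(\boldsymbol\theta/2)\|$. Here $\boldsymbol\theta=(\theta_1,\dots,\theta_k)$ are the principal angles $\theta_i=\arccos\sigma_i(Q^HQ')$ between $QQ^H$ and $Q'Q'^H$, where $\sigma_i$ denotes the $i$th largest singular value, the sine acts elementwise, and $\|\cdot\|$ is the Euclidean norm. With $d_{\mathrm{Gr}}$ the chosen distance, let $$\kappa[\mathcal{L}_\pi](A)=\lim_{\epsilon\to0^+}\ \sup_{\substack{A'\in\mathcal{U}_\pi,\ A'\ne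 A,\\ \|A-A'\|_F\le\epsilon}}\frac{d_{\mathrm{Gr}}(\mathcal{L}_\pi(A),\mathcal{L}_\pi(A'))}{\|A-A'\|_F}\in[0,\infty]$$ be Rice's condition number (a supremum over the empty set is $0$), and put $\kappa_\pi(A)=\kappa[\mathcal{L}_\pi](A)$ if $A\in\mathcal{U}_\pi$ and $\kappa_\pi(A)=\infty$ if $A\notin\mathcal{U}_\pi$. Then, for every $A\in\Bbbk^{m\times n}$ and for each of the three distances, $$\kappa_\pi(A)=\max_{i\in\pi,\ j\in\pi^c}\ \frac{1}{|\sigma_i-\sigma_j|}\sqrt{\frac{\sigma_i^2+\sigma_j^2}{(\sigma_i+\sigma_j)^2}},$$ where the term for $(i,j)$ is $\infty$ if $\sigma_i=\sigma_j$, and the right-hand side is $0$ if $\pi=\emptyset$ or $\pi^c=\emptyset$. -/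

import Mathlib

open scoped Matrix ENNReal Topology

noncomputable section

namespace SingularSubspace

/-! ### Rice's condition number -/

section Rice

variable {X Y : Type*}

/-- The supremum of `d_Y (f x) (f x') / d_X x x'` over all `x' ≠ x` in `X` with `d_X x x' ≤ ε`,
with values in `[0, ∞]`; it is `0` if there is no such `x'`. -/
def riceSup (dX : X → X → ℝ) (dY : Y → Y → ℝ) (f : X → Y) (x : X) (ε : ℝ) : ℝ≥0∞ :=
  ⨆ (x' : X) (_ : x' ≠ x ∧ dX x x' ≤ ε), ENNReal.ofReal (dY (f x) (f x') / dX x x')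

/-- Rice's condition number of `f` at `x` for the distances `dX`, `dY`: the limit of `riceSup` as
`ε → 0+`. As `riceSup` is monotone in `ε`, the limit is an infimum (see `tendsto_riceSup`). -/
def riceCond (dX : X → X → ℝ) (dY : Y → Y → ℝ) (f : X → Y) (x : X) : ℝ≥0∞ :=
  ⨅ (ε : ℝ) (_ : 0 < ε), riceSup dX dY f x ε

theorem riceSup_mono (dX : X → X → ℝ) (dY : Y → Y → ℝ) (f : X → Y) (x : X) :
    Monotone (riceSup dX dY f x) := by
  intro ε ε' h
  exact iSup_mono fun x' => iSup_le fun hx =>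
    le_iSup_of_le (⟨hx.1, hx.2.trans h⟩ : x' ≠ x ∧ dX x x' ≤ ε') le_rfl

theorem tendsto_riceSup (dX : X → X → ℝ) (dY : Y → Y → ℝ) (f : X → Y) (x : X) :
    Filter.Tendsto (riceSup dX dY f x) (𝓝[>] 0) (𝓝 (riceCond dX dY f x)) := by
  have h := (riceSup_mono dX dY f x).tendsto_nhdsGT (0 : ℝ)
  rwa [sInf_image] at h

end Rice

variable {𝕜 : Type*} [RCLike 𝕜] {m n : ℕ}

/-! ### Singular values, full singular value decompositions, left singular subspaces -/

/-- The singular values of `A` in decreasing order, repeated according to multiplicity, continued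
by zeros. The indexing starts at `0`, so `singVal A i` is `σ_{i+1}` in the usual one-based notation. -/
def singVal (A : Matrix (Fin m) (Fin n) 𝕜) (i : ℕ) : ℝ :=
  (Matrix.toEuclideanLin A).singularValues i

/-- The `m × n` matrix with the singular values of `A` on its diagonal and zeros elsewhere. -/
def sigmaHat (A : Matrix (Fin m) (Fin n) 𝕜) : Matrix (Fin m) (Fin n) 𝕜 :=
  Matrix.of fun i j => if (i : ℕ) = (j : ℕ) then ((singVal A i : ℝ) : 𝕜) else 0

/-- `A = U Σ Vᴴ` is a full singular value decomposition of `A`. -/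
def IsFullSVD (A : Matrix (Fin m) (Fin n) 𝕜) (U : Matrix (Fin m) (Fin m) 𝕜)
    (V : Matrix (Fin n) (Fin n) 𝕜) : Prop :=
  U ∈ Matrix.unitaryGroup (Fin m) 𝕜 ∧ V ∈ Matrix.unitaryGroup (Fin n) 𝕜 ∧
    A = U * sigmaHat A * Vᴴ

/-- The basic left singular subspace of `A` associated with `s ≥ 0`: the eigenspace of `A Aᴴ` for
the eigenvalue `s ^ 2`. For `s = 0` it is the cokernel of `A`. -/
def basicLeftSubspace (A : Matrix (Fin m) (Fin n) 𝕜) (s : ℝ) : Submodule 𝕜 (Fin m → 𝕜) :=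
  Module.End.eigenspace (Matrix.toLin' (A * Aᴴ)) ((s : 𝕜) ^ 2)

/-- `W` is a left singular subspace of `A`: it is the (direct) sum of the basic left singular
subspaces associated with a set `S ⊆ {σ_1, …, σ_r, 0}`. -/
def IsLeftSingularSubspace (A : Matrix (Fin m) (Fin n) 𝕜) (W : Submodule 𝕜 (Fin m → 𝕜)) : Prop :=
  ∃ S : Set ℝ, S ⊆ insert 0 (Set.range (singVal A)) ∧ W = ⨆ s ∈ S, basicLeftSubspace A s

/-- The linear span of the columns of `U` at the positions in `π`. -/
def colSpan (U : Matrix (Fin m) (Fin m) 𝕜) (π : Finset (Fin m)) : Submodule 𝕜 (Fin m → 𝕜) :=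
  Submodule.span 𝕜 (U.col '' (π : Set (Fin m)))

/-- `A ∈ 𝒰_π`: the subspace `U_π`, spanned by the columns at the positions in `π` of the factor `U`
in a full singular value decomposition of `A`, is a left singular subspace of `A`. -/
def domU (𝕜 : Type*) [RCLike 𝕜] (m n : ℕ) (π : Finset (Fin m)) : Set (Matrix (Fin m) (Fin n) 𝕜) :=
  {A | ∃ U V, IsFullSVD A U V ∧ IsLeftSingularSubspace A (colSpan U π)}

/-! ### The Grassmannian and its distances -/

/-- The Grassmannian `Gr(d, 𝕜^p)`, as the set of orthogonal projectors of rank `d`. -/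
def Gr (𝕜 : Type*) [RCLike 𝕜] (d p : ℕ) : Type _ :=
  {P : Matrix (Fin p) (Fin p) 𝕜 // ∃ Q : Matrix (Fin p) (Fin d) 𝕜, Qᴴ * Q = 1 ∧ P = Q * Qᴴ}

/-- A matrix `Q` with orthonormal columns that spans the point `P = Q Qᴴ` of the Grassmannian. -/
def Gr.frame {d p : ℕ} (P : Gr 𝕜 d p) : Matrix (Fin p) (Fin d) 𝕜 := P.2.choose

theorem Gr.frame_spec {d p : ℕ} (P : Gr 𝕜 d p) :
    P.frameᴴ * P.frame = 1 ∧ P.1 = P.frame * P.frameᴴ := P.2.choose_spec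

/-- The principal angles between `P = Q Qᴴ` and `P' = Q' Q'ᴴ`: `θ_i = arccos (σ_i (Qᴴ Q'))`. The
singular values of `Qᴴ Q'` do not depend on the choice of `Q` and `Q'`, which are unique up to
multiplication by unitary `d × d` matrices from the right. -/
def angle {d p : ℕ} (P P' : Gr 𝕜 d p) (i : Fin d) : ℝ :=
  Real.arccos (singVal (P.frameᴴ * P'.frame) i)

/-- The chordal distance `‖sin θ‖`. -/
def distChordal {d p : ℕ} (P P' : Gr 𝕜 d p) : ℝ :=
  √(∑ i, Real.sin (angle P P' i) ^ 2)

/-- The Grassmann distance `‖θ‖`. -/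
def distGrassmann {d p : ℕ} (P P' : Gr 𝕜 d p) : ℝ :=
  √(∑ i, angle P P' i ^ 2)

/-- The Procrustes distance `‖2 sin (θ / 2)‖`. -/
def distProcrustes {d p : ℕ} (P P' : Gr 𝕜 d p) : ℝ :=
  √(∑ i, (2 * Real.sin (angle P P' i / 2)) ^ 2)

/-- The Euclidean (Frobenius) distance of matrices. -/
def distFrob (A A' : Matrix (Fin m) (Fin n) 𝕜) : ℝ :=
  √(∑ i, ∑ j, ‖A i j - A' i j‖ ^ 2)

/-! ### The map to the left singular subspace and its condition number -/

/-- The columns of `U` at the positions in `π`, as an `m × #π` matrix. -/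
def selCols (U : Matrix (Fin m) (Fin m) 𝕜) (π : Finset (Fin m)) :
    Matrix (Fin m) (Fin π.card) 𝕜 :=
  U.submatrix id (π.orderEmbOfFin rfl)

theorem selCols_isometry {U : Matrix (Fin m) (Fin m) 𝕜} (hU : U ∈ Matrix.unitaryGroup (Fin m) 𝕜)
    (π : Finset (Fin m)) : (selCols U π)ᴴ * selCols U π = 1 := by
  have h : Uᴴ * U = 1 := Matrix.mem_unitaryGroup_iff'.mp hU
  have h2 : (selCols U π)ᴴ * selCols U π =
      (Uᴴ * U).submatrix (π.orderEmbOfFin rfl) (π.orderEmbOfFin rfl) := rfl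
  rw [h2, h]
  exact Matrix.submatrix_one _ (π.orderEmbOfFin rfl).injective

theorem conjTranspose_mulVec_col {U : Matrix (Fin m) (Fin m) 𝕜}
    (hU : U ∈ Matrix.unitaryGroup (Fin m) 𝕜) (i j : Fin m) :
    (Uᴴ *ᵥ U.col i) j = if j = i then 1 else 0 := by
  have h : Uᴴ * U = 1 := Matrix.mem_unitaryGroup_iff'.mp hU
  have h2 : (Uᴴ *ᵥ U.col i) j = (Uᴴ * U) j i := rfl
  rw [h2, h, Matrix.one_apply]

theorem mem_span_col_iff {U : Matrix (Fin m) (Fin m) 𝕜}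
    (hU : U ∈ Matrix.unitaryGroup (Fin m) 𝕜) (T : Set (Fin m)) (w : Fin m → 𝕜) :
    w ∈ Submodule.span 𝕜 (U.col '' T) ↔ ∀ i, i ∉ T → (Uᴴ *ᵥ w) i = 0 := by
  constructor
  · intro hw i hi
    induction hw using Submodule.span_induction with
    | mem x hx =>
      obtain ⟨j, hj, rfl⟩ := hx
      rw [conjTranspose_mulVec_col hU, if_neg]
      rintro rfl
      exact hi hj
    | zero => simp
    | add x y _ _ hx hy => simp [Matrix.mulVec_add, hx, hy]
    | smul a x _ hx => simp [Matrix.mulVec_smul, hx]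
  · intro h
    have h1 : U * Uᴴ = 1 := Matrix.mem_unitaryGroup_iff.mp hU
    have h2 : w = ∑ i, (Uᴴ *ᵥ w) i • U.col i := by
      conv_lhs => rw [← Matrix.one_mulVec w, ← h1, ← Matrix.mulVec_mulVec]
      ext k
      simp [Matrix.mulVec, dotProduct, mul_comm]
    rw [h2]
    refine Submodule.sum_mem _ fun i _ => ?_
    by_cases hi : i ∈ T
    · exact Submodule.smul_mem _ _ (Submodule.subset_span ⟨i, hi, rfl⟩)
    · rw [h i hi, zero_smul]
      exact Submodule.zero_mem _

theorem singVal_nonneg (A : Matrix (Fin m) (Fin n) 𝕜) (i : ℕ) : 0 ≤ singVal A i :=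
  LinearMap.singularValues_nonneg _ i

theorem singVal_of_le (A : Matrix (Fin m) (Fin n) 𝕜) {i : ℕ} (h : n ≤ i) : singVal A i = 0 :=
  LinearMap.singularValues_of_finrank_le _ (by simpa using h)

theorem sigmaHat_mul (A : Matrix (Fin m) (Fin n) 𝕜) :
    sigmaHat A * (sigmaHat A)ᴴ =
      Matrix.diagonal fun i : Fin m => ((singVal A i : ℝ) : 𝕜) ^ 2 := by
  ext i k
  rw [Matrix.mul_apply]
  by_cases hi : (i : ℕ) < n
  · rw [Finset.sum_eq_single (⟨i, hi⟩ : Fin n)]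
    · by_cases hk : i = k
      · subst hk
        simp [sigmaHat, sq]
      · have : (k : ℕ) ≠ i := fun h => hk (Fin.ext h.symm)
        simp [sigmaHat, hk, this]
    · intro j _ hj
      have : (i : ℕ) ≠ j := fun h => hj (Fin.ext h.symm)
      simp [sigmaHat, this]
    · simp
  · rw [Finset.sum_eq_zero]
    · by_cases hk : i = k
      · subst hk
        simp [singVal_of_le A (not_lt.mp hi)]
      · simp [hk]
    · intro j _
      have : (i : ℕ) ≠ j := fun h => hi (h ▸ j.2)
      simp [sigmaHat, this]

theorem basicLeftSubspace_eq {A : Matrix (Fin m) (Fin n) 𝕜} {U V}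
    (h : IsFullSVD A U V) {s : ℝ} (hs : 0 ≤ s) :
    basicLeftSubspace A s =
      Submodule.span 𝕜 (U.col '' {i : Fin m | singVal A i = s}) := by
  obtain ⟨hU, hV, hA⟩ := h
  have hU1 : Uᴴ * U = 1 := Matrix.mem_unitaryGroup_iff'.mp hU
  have hU2 : U * Uᴴ = 1 := Matrix.mem_unitaryGroup_iff.mp hU
  have hV1 : Vᴴ * V = 1 := Matrix.mem_unitaryGroup_iff'.mp hV
  have hAA : Uᴴ * (A * Aᴴ) =
      (Matrix.diagonal fun i : Fin m => ((singVal A i : ℝ) : 𝕜) ^ 2) * Uᴴ := by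
    rw [← sigmaHat_mul]
    conv_lhs => rw [hA]
    generalize sigmaHat A = E
    simp only [Matrix.conjTranspose_mul, Matrix.conjTranspose_conjTranspose]
    calc Uᴴ * (U * E * Vᴴ * (V * (Eᴴ * Uᴴ)))
        = (Uᴴ * U) * E * (Vᴴ * V) * (Eᴴ * Uᴴ) := by simp only [Matrix.mul_assoc]
      _ = E * Eᴴ * Uᴴ := by rw [hU1, hV1]; simp [Matrix.mul_assoc]
  have key : ∀ w : Fin m → 𝕜, ∀ i, (Uᴴ *ᵥ ((A * Aᴴ) *ᵥ w)) i =
      ((singVal A i : ℝ) : 𝕜) ^ 2 * (Uᴴ *ᵥ w) i := by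
    intro w i
    rw [Matrix.mulVec_mulVec, hAA, ← Matrix.mulVec_mulVec, Matrix.mulVec_diagonal]
  ext w
  rw [mem_span_col_iff hU, basicLeftSubspace, Module.End.mem_eigenspace_iff,
    Matrix.toLin'_apply]
  constructor
  · intro hw i hi
    have h1 := key w i
    rw [hw, Matrix.mulVec_smul, Pi.smul_apply, smul_eq_mul] at h1
    by_contra h0
    have h2 := mul_right_cancel₀ h0 h1
    apply hi
    have h3 : s ^ 2 = singVal A i ^ 2 := by exact_mod_cast h2
    exact ((pow_left_inj₀ hs (singVal_nonneg A i) two_ne_zero).mp h3).symm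
  · intro hw
    have h1 : Uᴴ *ᵥ ((A * Aᴴ) *ᵥ w) = Uᴴ *ᵥ ((s : 𝕜) ^ 2 • w) := by
      ext i
      rw [key, Matrix.mulVec_smul, Pi.smul_apply, smul_eq_mul]
      by_cases hi : singVal A i = s
      · rw [hi]
      · rw [hw i hi, mul_zero, mul_zero]
    have h2 := congrArg (fun v => U *ᵥ v) h1
    simpa [Matrix.mulVec_mulVec, ← Matrix.mul_assoc, hU2] using h2

theorem iSup_basicLeftSubspace_eq {A : Matrix (Fin m) (Fin n) 𝕜} {U V}
    (h : IsFullSVD A U V) {S : Set ℝ} (hS : ∀ s ∈ S, 0 ≤ s) :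
    ⨆ s ∈ S, basicLeftSubspace A s =
      Submodule.span 𝕜 (U.col '' {i : Fin m | singVal A i ∈ S}) := by
  apply le_antisymm
  · refine iSup₂_le fun s hs => ?_
    rw [basicLeftSubspace_eq h (hS s hs)]
    exact Submodule.span_mono (Set.image_mono fun i hi => by
      change singVal A i ∈ S
      rwa [show singVal A i = s from hi])
  · rw [Submodule.span_le]
    rintro _ ⟨i, hi, rfl⟩
    refine (le_iSup₂_of_le (singVal A i) hi le_rfl : basicLeftSubspace A (singVal A i) ≤ _) ?_
    rw [basicLeftSubspace_eq h (singVal_nonneg A i)]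
    exact Submodule.subset_span ⟨i, rfl, rfl⟩

theorem colSpan_eq {A : Matrix (Fin m) (Fin n) 𝕜} {U V U' V'} (h : IsFullSVD A U V)
    (h' : IsFullSVD A U' V') {π : Finset (Fin m)} (hW : IsLeftSingularSubspace A (colSpan U π)) :
    colSpan U' π = colSpan U π := by
  obtain ⟨S, hS, hW⟩ := hW
  have hS0 : ∀ s ∈ S, 0 ≤ s := by
    intro s hs
    rcases hS hs with rfl | ⟨i, rfl⟩
    · exact le_rfl
    · exact singVal_nonneg A i
  have hT : (π : Set (Fin m)) = {i : Fin m | singVal A i ∈ S} := by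
    rw [iSup_basicLeftSubspace_eq h hS0] at hW
    have aux : ∀ (T : Set (Fin m)) (i : Fin m),
        U.col i ∈ Submodule.span 𝕜 (U.col '' T) ↔ i ∈ T := by
      intro T i
      rw [mem_span_col_iff h.1]
      constructor
      · intro hi
        by_contra hiT
        have := hi i hiT
        rw [conjTranspose_mulVec_col h.1, if_pos rfl] at this
        exact one_ne_zero this
      · intro hi j hj
        rw [conjTranspose_mulVec_col h.1, if_neg]
        rintro rfl
        exact hj hi
    ext i
    rw [← aux, ← aux]
    exact SetLike.ext_iff.mp hW (U.col i)
  rw [hW, iSup_basicLeftSubspace_eq h' hS0, colSpan, hT]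

theorem selCols_mul (U : Matrix (Fin m) (Fin m) 𝕜) (π : Finset (Fin m)) :
    selCols U π * (selCols U π)ᴴ =
      U * Matrix.diagonal (fun i => if i ∈ π then 1 else 0) * Uᴴ := by
  ext a b
  rw [Matrix.mul_apply, Matrix.mul_apply]
  simp only [Matrix.mul_diagonal, Matrix.conjTranspose_apply, selCols, Matrix.submatrix_apply,
    id_eq, mul_ite, mul_one, mul_zero, ite_mul, zero_mul]
  rw [← Finset.sum_filter, Finset.filter_mem_eq_inter, Finset.univ_inter]
  have := Finset.sum_map Finset.univ (π.orderEmbOfFin rfl).toEmbedding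
    (fun x => U a x * star (U b x))
  rw [Finset.map_orderEmbOfFin_univ] at this
  exact this.symm

theorem selCols_mul_eq {U U' : Matrix (Fin m) (Fin m) 𝕜}
    (hU : U ∈ Matrix.unitaryGroup (Fin m) 𝕜) (hU' : U' ∈ Matrix.unitaryGroup (Fin m) 𝕜)
    {π : Finset (Fin m)} (h : colSpan U' π = colSpan U π) :
    selCols U' π * (selCols U' π)ᴴ = selCols U π * (selCols U π)ᴴ := by
  have aux : ∀ {U U' : Matrix (Fin m) (Fin m) 𝕜}, U ∈ Matrix.unitaryGroup (Fin m) 𝕜 →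
      colSpan U' π = colSpan U π → ∀ i j, i ∉ π → j ∈ π → (Uᴴ * U') i j = 0 := by
    intro U U' hU h i j hi hj
    have h1 : U'.col j ∈ colSpan U π := h ▸ Submodule.subset_span ⟨j, hj, rfl⟩
    exact (mem_span_col_iff hU _ _).mp h1 i hi
  have hc : (Matrix.diagonal (fun i => if i ∈ π then 1 else 0)) * (Uᴴ * U') =
      (Uᴴ * U') * (Matrix.diagonal (fun i => if i ∈ π then 1 else 0)) := by
    ext i j
    rw [Matrix.diagonal_mul, Matrix.mul_diagonal]
    by_cases hi : i ∈ π <;> by_cases hj : j ∈ π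
    · simp [hi, hj]
    · have h1 : (Uᴴ * U') i j = star ((U'ᴴ * U) j i) := by
        rw [← Matrix.conjTranspose_apply, Matrix.conjTranspose_mul,
          Matrix.conjTranspose_conjTranspose]
      rw [h1, aux hU' h.symm j i hj hi]
      simp
    · rw [aux hU h i j hi hj]
      simp
    · simp [hi, hj]
  have h1 : U * Uᴴ = 1 := Matrix.mem_unitaryGroup_iff.mp hU
  have h2 : U' * U'ᴴ = 1 := Matrix.mem_unitaryGroup_iff.mp hU'
  rw [selCols_mul, selCols_mul]
  generalize Matrix.diagonal (fun i => if i ∈ π then (1 : 𝕜) else 0) = E at hc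
  calc U' * E * U'ᴴ = (U * Uᴴ) * U' * E * U'ᴴ := by rw [h1, Matrix.one_mul]
    _ = U * ((Uᴴ * U') * E) * U'ᴴ := by simp only [Matrix.mul_assoc]
    _ = U * E * Uᴴ * (U' * U'ᴴ) := by rw [← hc]; simp only [Matrix.mul_assoc]
    _ = U * E * Uᴴ := by rw [h2, Matrix.mul_one]

/-- The map `ℒ_π : 𝒰_π → Gr(#π, 𝕜^m)`, `A ↦ U_π`. The value does not depend on the choice of the
full singular value decomposition (see `leftMap_eq`). -/
def leftMap (π : Finset (Fin m)) (A : domU 𝕜 m n π) : Gr 𝕜 π.card m :=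
  ⟨selCols A.2.choose π * (selCols A.2.choose π)ᴴ, selCols A.2.choose π,
    selCols_isometry A.2.choose_spec.choose_spec.1.1 π, rfl⟩

/-- `ℒ_π(A)` is the projector onto the span of the columns at the positions in `π` of the left
factor of any full singular value decomposition of `A`. -/
theorem leftMap_eq (π : Finset (Fin m)) (A : domU 𝕜 m n π) {U V} (h : IsFullSVD A.1 U V) :
    (leftMap π A).1 = selCols U π * (selCols U π)ᴴ :=
  (selCols_mul_eq A.2.choose_spec.choose_spec.1.1 h.1
    (colSpan_eq A.2.choose_spec.choose_spec.1 h A.2.choose_spec.choose_spec.2)).symm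

open Classical in
/-- `κ_π(A)`: the condition number of `ℒ_π` at `A` for the Euclidean distance on `𝒰_π` and the
distance `dGr` on the Grassmannian if `A ∈ 𝒰_π`, and `∞` otherwise. -/
def kappa (π : Finset (Fin m)) (dGr : Gr 𝕜 π.card m → Gr 𝕜 π.card m → ℝ)
    (A : Matrix (Fin m) (Fin n) 𝕜) : ℝ≥0∞ :=
  if h : A ∈ domU 𝕜 m n π then
    riceCond (fun B B' : domU 𝕜 m n π => distFrob B.1 B'.1) dGr (leftMap π) ⟨A, h⟩
  else ⊤

/-- `|s - t|⁻¹ √((s ^ 2 + t ^ 2) / (s + t) ^ 2)` for `s, t ≥ 0`, equal to `∞` if `s = t`. -/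
def pairCond (s t : ℝ) : ℝ≥0∞ :=
  if s = t then ⊤ else ENNReal.ofReal (1 / |s - t| * √((s ^ 2 + t ^ 2) / (s + t) ^ 2))

/-- The maximum of `pairCond σ_i σ_j` over `i ∈ π` and `j ∉ π`; it is `0` if there are no such
pairs. -/
def maxPairCond (π : Finset (Fin m)) (A : Matrix (Fin m) (Fin n) 𝕜) : ℝ≥0∞ :=
  ⨆ i ∈ π, ⨆ j ∈ πᶜ, pairCond (singVal A (i : Fin m)) (singVal A (j : Fin m))

end SingularSubspace

end

/-!
The argument replaces the derivative of the singular subspace map by exact identities.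

*Distances.* If `P = Q Qᴴ` and `P' = Q' Q'ᴴ`, then `∑ sin² θ_i = k - ‖Qᴴ Q'‖_F²`. For
`P = ℒ_π(A)`, `P' = ℒ_π(A')` and left factors `U`, `U'`, this is the squared Frobenius norm of an
off-diagonal block of the unitary matrix `W = Uᴴ U'` (`distChordal_leftMap_sq`), and the two
off-diagonal blocks have the same norm (`sum_offDiag_block_comm`). The other two distances lie above
the chordal one and agree with it to first order (`distGrassmann_mul_le`), so all three are treated
at once in `kappa_eq`.

*Upper bound.* With `F = Uᴴ (A - A') V'` and `G = U'ᴴ (A - A') V`, the factorizations of `A` and `A'`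
give `(σ_i² - σ'_j²) W_ij = σ'_j F_ij + σ_i conj G_ji` (`sylvester_entry`), and
`‖F‖_F = ‖G‖_F = ‖A - A'‖_F`. The Cauchy-Schwarz inequality for each entry, summed over both
off-diagonal blocks, bounds `2 ∑ sin² θ_i` by `2 ‖A - A'‖_F²` times the maximum of
`(σ_i² + σ'_j²) / (σ_i² - σ'_j²)²` over the pairs separated by `π` (`distChordal_leftMap_le`). By
Weyl's inequality `σ'` tends to `σ` as `A'` tends to `A`, which yields the formula in the limit
(`riceCond_le`).

*Lower bound.* For `i ∈ π` and `j ∉ π`, the left singular vectors `i` and `j` are rotated by an angle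
of sine `x`, and the right ones by an angle of sine `λ x` with `λ = 2 σ_i σ_j / (σ_i² + σ_j²)`. The
singular values do not change, so the new matrix stays in `𝒰_π`; the chordal distance is exactly `x`,
and `‖A - A'‖_F² = x² (σ_i² - σ_j²)² / (σ_i² + σ_j²) + O(x⁴)` (`exists_rotated`).

*Outside `𝒰_π`.* `A ∈ 𝒰_π` if and only if no singular value occurs both inside and outside of `π`
(`mem_domU_iff`); otherwise both sides are `∞`.
-/

noncomputable section

namespace SingularSubspace

variable {𝕜 : Type*} [RCLike 𝕜] {m n p : ℕ}

/-! ### The squared Frobenius norm -/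

/-- The squared Frobenius norm. -/
def frobSq {ι κ : Type*} [Fintype ι] [Fintype κ] (M : Matrix ι κ 𝕜) : ℝ :=
  ∑ i, ∑ j, ‖M i j‖ ^ 2

section FrobSq

variable {ι κ l : Type*} [Fintype ι] [Fintype κ] [Fintype l]

theorem frobSq_nonneg (M : Matrix ι κ 𝕜) : 0 ≤ frobSq M := by
  unfold frobSq; positivity

theorem frobSq_conjTranspose (M : Matrix ι κ 𝕜) : frobSq Mᴴ = frobSq M := by
  unfold frobSq
  rw [Finset.sum_comm]
  simp

theorem ofReal_frobSq (M : Matrix ι κ 𝕜) : ((frobSq M : ℝ) : 𝕜) = (Mᴴ * M).trace := by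
  unfold frobSq
  rw [Finset.sum_comm]
  simp only [Matrix.trace, Matrix.diag_apply, Matrix.mul_apply, Matrix.conjTranspose_apply]
  push_cast
  refine Finset.sum_congr rfl fun j _ => Finset.sum_congr rfl fun i _ => ?_
  rw [RCLike.star_def, RCLike.conj_mul]

theorem frobSq_isometry_mul [DecidableEq κ] {Q : Matrix ι κ 𝕜} (hQ : Qᴴ * Q = 1)
    (M : Matrix κ l 𝕜) : frobSq (Q * M) = frobSq M := by
  have h : ((frobSq (Q * M) : ℝ) : 𝕜) = ((frobSq M : ℝ) : 𝕜) := by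
    rw [ofReal_frobSq, ofReal_frobSq, Matrix.conjTranspose_mul, Matrix.mul_assoc,
      ← Matrix.mul_assoc Qᴴ, hQ, Matrix.one_mul]
  exact_mod_cast h

theorem frobSq_mul_coisometry [DecidableEq κ] (M : Matrix l κ 𝕜) {Q : Matrix κ ι 𝕜}
    (hQ : Q * Qᴴ = 1) : frobSq (M * Q) = frobSq M := by
  rw [← frobSq_conjTranspose, Matrix.conjTranspose_mul, frobSq_isometry_mul, frobSq_conjTranspose]
  simpa using hQ

/-- `‖Qᴴ R‖_F` depends on `Q` and `R` only through the matrices `Q Qᴴ` and `R Rᴴ`. -/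
theorem frobSq_conjTranspose_mul_congr {κ' l' : Type*} [Fintype κ'] [Fintype l']
    {Q : Matrix ι κ 𝕜} {Q' : Matrix ι κ' 𝕜}
    {R : Matrix ι l 𝕜} {R' : Matrix ι l' 𝕜} (hQ : Q * Qᴴ = Q' * Q'ᴴ) (hR : R * Rᴴ = R' * R'ᴴ) :
    frobSq (Qᴴ * R) = frobSq (Q'ᴴ * R') := by
  have key : ∀ {κ l : Type _} [Fintype κ] [Fintype l] (Q : Matrix ι κ 𝕜) (R : Matrix ι l 𝕜),
      ((frobSq (Qᴴ * R) : ℝ) : 𝕜) = ((Q * Qᴴ) * (R * Rᴴ)).trace := by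
    intro κ l _ _ Q R
    rw [ofReal_frobSq, Matrix.conjTranspose_mul, Matrix.conjTranspose_conjTranspose,
      Matrix.mul_assoc, Matrix.trace_mul_comm]
    simp only [Matrix.mul_assoc]
  have h : ((frobSq (Qᴴ * R) : ℝ) : 𝕜) = ((frobSq (Q'ᴴ * R') : ℝ) : 𝕜) := by
    rw [key, hQ, hR]
    rw [ofReal_frobSq, Matrix.conjTranspose_mul, Matrix.conjTranspose_conjTranspose,
      Matrix.mul_assoc R'ᴴ, Matrix.trace_mul_comm R'ᴴ]
    simp only [Matrix.mul_assoc]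
  exact_mod_cast h

end FrobSq

theorem distFrob_eq (A A' : Matrix (Fin m) (Fin n) 𝕜) : distFrob A A' = √(frobSq (A - A')) := rfl

/-! ### Singular value decompositions -/

/-- The rectangular diagonal matrix with real diagonal entries `d 0, d 1, …`. -/
def diagRect (𝕜 : Type*) [RCLike 𝕜] (m n : ℕ) (d : ℕ → ℝ) : Matrix (Fin m) (Fin n) 𝕜 :=
  Matrix.of fun i j => if (i : ℕ) = (j : ℕ) then ((d i : ℝ) : 𝕜) else 0

theorem diagRect_singVal (A : Matrix (Fin m) (Fin n) 𝕜) :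
    diagRect 𝕜 m n (singVal A) = sigmaHat A := rfl

theorem mul_diagRect_apply {ι : Type*} (M : Matrix ι (Fin m) 𝕜) (d : ℕ → ℝ) (i : ι)
    (j : Fin n) :
    (M * diagRect 𝕜 m n d) i j = if h : (j : ℕ) < m then M i ⟨j, h⟩ * (d j : 𝕜) else 0 := by
  rw [Matrix.mul_apply]
  split_ifs with h
  · rw [Finset.sum_eq_single (⟨j, h⟩ : Fin m)]
    · simp [diagRect]
    · intro k _ hk
      have : (k : ℕ) ≠ j := fun h => hk (Fin.ext h)
      simp [diagRect, this]
    · simp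
  · refine Finset.sum_eq_zero fun k _ => ?_
    have : (k : ℕ) ≠ j := by omega
    simp [diagRect, this]

theorem diagRect_conjTranspose (d : ℕ → ℝ) : (diagRect 𝕜 m n d)ᴴ = diagRect 𝕜 n m d := by
  ext i j
  by_cases h : (i : ℕ) = j
  · simp [diagRect, h]
  · simp [diagRect, h, Ne.symm h]

theorem diagRect_mul_apply {ι : Type*} (d : ℕ → ℝ) (M : Matrix (Fin n) ι 𝕜) (i : Fin m)
    (j : ι) :
    (diagRect 𝕜 m n d * M) i j = if h : (i : ℕ) < n then (d i : 𝕜) * M ⟨i, h⟩ j else 0 := by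
  rw [Matrix.mul_apply]
  split_ifs with h
  · rw [Finset.sum_eq_single (⟨i, h⟩ : Fin n)]
    · simp [diagRect]
    · intro k _ hk
      have : (i : ℕ) ≠ k := fun h => hk (Fin.ext h.symm)
      simp [diagRect, this]
    · simp
  · refine Finset.sum_eq_zero fun k _ => ?_
    have : (i : ℕ) ≠ k := by omega
    simp [diagRect, this]

/-- Right singular vectors are the eigenvectors of `Aᴴ A`, left singular vectors their normalized
images, completed to an orthonormal basis. -/
theorem exists_isFullSVD (A : Matrix (Fin m) (Fin n) 𝕜) : ∃ U V, IsFullSVD A U V := by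
  set T := Matrix.toEuclideanLin A with hT
  have hn : Module.finrank 𝕜 (EuclideanSpace 𝕜 (Fin n)) = n := by simp
  set b := T.isSymmetric_adjoint_comp_self.eigenvectorBasis hn with hb
  have hin : ∀ i j : Fin n, inner 𝕜 (T (b i)) (T (b j)) =
      if i = j then ((singVal A j : ℝ) : 𝕜) ^ 2 else 0 := by
    intro i j
    rw [← LinearMap.adjoint_inner_right]
    have := T.isSymmetric_adjoint_comp_self.apply_eigenvectorBasis hn j
    rw [LinearMap.comp_apply] at this
    rw [this, inner_smul_right, ← hb, orthonormal_iff_ite.mp b.orthonormal i j,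
      ← T.sq_singularValues_fin hn j]
    split_ifs <;> simp [singVal, hT]
  have hrank : ∀ i, singVal A i ≠ 0 → i < m := by
    intro i hi
    have h1 : 0 < T.singularValues i := (T.singularValues_pos_iff_ne_zero i).mpr hi
    rw [T.singularValues_pos_iff_lt_finrank_range] at h1
    refine h1.trans_le ((Submodule.finrank_le _).trans (by simp))
  let w : Fin m → EuclideanSpace 𝕜 (Fin m) := fun i =>
    if h : (i : ℕ) < n then ((singVal A i : ℝ) : 𝕜)⁻¹ • T (b ⟨i, h⟩) else 0
  let s : Set (Fin m) := {i | singVal A i ≠ 0}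
  have hlt : ∀ i ∈ s, (i : ℕ) < n := by
    intro i hi
    by_contra h
    exact hi (singVal_of_le A (not_lt.mp h))
  have hw : Orthonormal 𝕜 (s.domRestrict w) := by
    rw [orthonormal_iff_ite]
    rintro ⟨i, hi⟩ ⟨j, hj⟩
    have hi0 : ((singVal A i : ℝ) : 𝕜) ≠ 0 := by exact_mod_cast hi
    simp only [Set.domRestrict_apply, w, hlt i hi, hlt j hj, dif_pos, inner_smul_left,
      inner_smul_right, hin]
    by_cases hij : i = j
    · subst hij
      simp only [if_true, map_inv₀, RCLike.conj_ofReal]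
      field_simp
    · have : (i : ℕ) ≠ j := fun h => hij (Fin.ext h)
      simp [hij, this]
  obtain ⟨u, hu⟩ := hw.exists_orthonormalBasis_extension_of_card_eq (by simp)
  have hU := (EuclideanSpace.basisFun (Fin m) 𝕜).toMatrix_orthonormalBasis_mem_unitary u
  have hV := (EuclideanSpace.basisFun (Fin n) 𝕜).toMatrix_orthonormalBasis_mem_unitary b
  refine ⟨_, _, hU, hV, ?_⟩
  set U := (EuclideanSpace.basisFun (Fin m) 𝕜).toBasis.toMatrix u
  set V := (EuclideanSpace.basisFun (Fin n) 𝕜).toBasis.toMatrix b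
  have hUa : ∀ i j, U i j = u j i := fun i j => by
    simp [U, Module.Basis.toMatrix_apply]
  have hVa : ∀ i j, V i j = b j i := fun i j => by
    simp [V, Module.Basis.toMatrix_apply]
  have hVV : V * Vᴴ = 1 := Matrix.mem_unitaryGroup_iff.mp hV
  suffices h : A * V = U * sigmaHat A by
    rw [← h, Matrix.mul_assoc, hVV, Matrix.mul_one]
  ext i j
  have h1 : (A * V) i j = T (b j) i := by
    rw [hT, Matrix.ofLp_toLpLin]
    simp [Matrix.toLin'_apply, Matrix.mul_apply, Matrix.mulVec, dotProduct, hVa]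
  rw [h1, ← diagRect_singVal, mul_diagRect_apply]
  by_cases h0 : singVal A j = 0
  · have : T (b j) = 0 := by
      rw [← inner_self_eq_zero (𝕜 := 𝕜), hin, if_pos rfl, h0]; simp
    simp [this, h0]
  · have hjm := hrank j h0
    have h0' : ((singVal A j : ℝ) : 𝕜) ≠ 0 := by exact_mod_cast h0
    rw [dif_pos hjm, hUa, hu ⟨j, hjm⟩ h0]
    simp only [w, j.2, dif_pos, Fin.eta, PiLp.smul_apply, smul_eq_mul]
    field_simp

/-! ### Perturbation of singular values -/

/-- The Euclidean norm of a coordinate vector. -/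
def vecNorm {ι : Type*} [Fintype ι] (x : ι → 𝕜) : ℝ := ‖WithLp.toLp 2 x‖

theorem vecNorm_nonneg {ι : Type*} [Fintype ι] (x : ι → 𝕜) : 0 ≤ vecNorm x := norm_nonneg _

theorem vecNorm_sq {ι : Type*} [Fintype ι] (x : ι → 𝕜) : vecNorm x ^ 2 = ∑ i, ‖x i‖ ^ 2 := by
  rw [vecNorm, EuclideanSpace.norm_sq_eq]

theorem vecNorm_sq_eq_frobSq {ι : Type*} [Fintype ι] (x : ι → 𝕜) :
    vecNorm x ^ 2 = frobSq (Matrix.replicateCol Unit x) := by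
  simp [vecNorm_sq, frobSq]

theorem vecNorm_isometry_mulVec {ι κ : Type*} [Fintype ι] [Fintype κ] [DecidableEq κ]
    {Q : Matrix ι κ 𝕜} (hQ : Qᴴ * Q = 1) (x : κ → 𝕜) : vecNorm (Q *ᵥ x) = vecNorm x := by
  rw [← pow_left_inj₀ (vecNorm_nonneg _) (vecNorm_nonneg _) two_ne_zero,
    vecNorm_sq_eq_frobSq, vecNorm_sq_eq_frobSq, Matrix.replicateCol_mulVec,
    frobSq_isometry_mul hQ]

theorem vecNorm_mulVec_le {ι κ : Type*} [Fintype ι] [Fintype κ]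
    (M : Matrix ι κ 𝕜) (x : κ → 𝕜) : vecNorm (M *ᵥ x) ≤ √(frobSq M) * vecNorm x := by
  rw [← pow_le_pow_iff_left₀ (vecNorm_nonneg _)
    (mul_nonneg (Real.sqrt_nonneg _) (vecNorm_nonneg _)) two_ne_zero,
    mul_pow, Real.sq_sqrt (frobSq_nonneg M), vecNorm_sq, vecNorm_sq, frobSq, Finset.sum_mul]
  refine Finset.sum_le_sum fun i _ => ?_
  have h : ‖(M *ᵥ x) i‖ ≤ ∑ j, ‖M i j‖ * ‖x j‖ :=
    (norm_sum_le _ _).trans (Finset.sum_le_sum fun j _ => (norm_mul _ _).le)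
  exact (pow_le_pow_left₀ (norm_nonneg _) h 2).trans (Finset.sum_mul_sq_le_sq_mul_sq _ _ _)

/-- Weyl's inequality. The factorizations need not be formed with `singVal`, so that the inequality
also shows the uniqueness of singular values (`isFullSVD_of_eq`). -/
theorem sub_le_sqrt_frobSq {U U' : Matrix (Fin m) (Fin m) 𝕜} {V V' : Matrix (Fin n) (Fin n) 𝕜}
    (hU : U ∈ Matrix.unitaryGroup (Fin m) 𝕜) (hV : V ∈ Matrix.unitaryGroup (Fin n) 𝕜)
    (hU' : U' ∈ Matrix.unitaryGroup (Fin m) 𝕜) (hV' : V' ∈ Matrix.unitaryGroup (Fin n) 𝕜)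
    {d d' : ℕ → ℝ} (hd : Antitone d) (hd' : Antitone d') (h0 : ∀ i, 0 ≤ d i)
    (h0' : ∀ i, 0 ≤ d' i) {k : ℕ} (hkm : k < m) (hkn : k < n) :
    d k - d' k ≤ √(frobSq (U * diagRect 𝕜 m n d * Vᴴ - U' * diagRect 𝕜 m n d' * V'ᴴ)) := by
  set A := U * diagRect 𝕜 m n d * Vᴴ with hA
  set A' := U' * diagRect 𝕜 m n d' * V'ᴴ with hA'
  -- A vector orthogonal to the trailing columns of `V` and to the leading columns of `V'`.
  obtain ⟨x, hx0, hx⟩ : ∃ x : Fin n → 𝕜, x ≠ 0 ∧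
      (∀ j : Fin n, k < j → (Vᴴ *ᵥ x) j = 0) ∧ ∀ j : Fin n, (j : ℕ) < k → (V'ᴴ *ᵥ x) j = 0 := by
    let N : Matrix (Fin n) (Fin n) 𝕜 := Matrix.of fun j =>
      if k < j then Vᴴ j else if (j : ℕ) < k then V'ᴴ j else 0
    have hN : N.det = 0 := Matrix.det_eq_zero_of_row_eq_zero (⟨k, hkn⟩ : Fin n) (by simp [N])
    obtain ⟨x, hx0, hx⟩ := Matrix.exists_mulVec_eq_zero_iff.mpr hN
    refine ⟨x, hx0, fun j hj => ?_, fun j hj => ?_⟩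
    · have := congrFun hx j
      simpa [N, Matrix.mulVec, hj] using this
    · have := congrFun hx j
      simpa [N, Matrix.mulVec, hj, hj.le.not_gt] using this
  have hxpos : 0 < vecNorm x := by
    rw [vecNorm, norm_pos_iff]
    simpa using hx0
  have hVx : vecNorm (Vᴴ *ᵥ x) = vecNorm x := vecNorm_isometry_mulVec (by
    rw [Matrix.conjTranspose_conjTranspose]; exact Matrix.mem_unitaryGroup_iff.mp hV) x
  have hVx' : vecNorm (V'ᴴ *ᵥ x) = vecNorm x := vecNorm_isometry_mulVec (by
    rw [Matrix.conjTranspose_conjTranspose]; exact Matrix.mem_unitaryGroup_iff.mp hV') x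
  have hdiag : ∀ (d : ℕ → ℝ) (y : Fin n → 𝕜), vecNorm (diagRect 𝕜 m n d *ᵥ y) ^ 2 =
      ∑ j : Fin n, if (j : ℕ) < m then d j ^ 2 * ‖y j‖ ^ 2 else 0 := by
    intro d y
    have h1 : ∀ i : Fin m, ‖(diagRect 𝕜 m n d *ᵥ y) i‖ ^ 2 =
        ∑ j : Fin n, if (i : ℕ) = j then d j ^ 2 * ‖y j‖ ^ 2 else 0 := by
      intro i
      have h2 : (diagRect 𝕜 m n d *ᵥ y) i =
          (diagRect 𝕜 m n d * Matrix.replicateCol Unit y) i () := by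
        rw [← Matrix.replicateCol_mulVec]
        rfl
      rw [h2, diagRect_mul_apply]
      split_ifs with h
      · rw [Finset.sum_eq_single (⟨i, h⟩ : Fin n)]
        · simp [mul_pow]
        · intro j _ hj
          rw [if_neg fun h => hj (Fin.ext h.symm)]
        · simp
      · rw [Finset.sum_eq_zero, norm_zero, sq, zero_mul]
        intro j _
        rw [if_neg (by omega)]
    rw [vecNorm_sq, Finset.sum_congr rfl fun i _ => h1 i, Finset.sum_comm]
    refine Finset.sum_congr rfl fun j _ => ?_
    split_ifs with h
    · rw [Finset.sum_eq_single (⟨j, h⟩ : Fin m)]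
      · simp
      · intro i _ hi
        rw [if_neg fun h => hi (Fin.ext h)]
      · simp
    · refine Finset.sum_eq_zero fun i _ => ?_
      rw [if_neg (by omega)]
  have hlow : d k * vecNorm x ≤ vecNorm (A *ᵥ x) := by
    rw [hA, Matrix.mul_assoc, ← Matrix.mulVec_mulVec, ← Matrix.mulVec_mulVec,
      vecNorm_isometry_mulVec (Matrix.mem_unitaryGroup_iff'.mp hU), ← hVx,
      ← pow_le_pow_iff_left₀ (mul_nonneg (h0 k) (vecNorm_nonneg _)) (vecNorm_nonneg _) two_ne_zero,
      hdiag, mul_pow, vecNorm_sq, Finset.mul_sum]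
    refine Finset.sum_le_sum fun j _ => ?_
    rcases lt_or_ge k j with hj | hj
    · simp [hx.1 j hj]
    · rw [if_pos (hj.trans_lt hkm)]
      have := h0 k
      gcongr
      exact hd hj
  have hupp : vecNorm (A' *ᵥ x) ≤ d' k * vecNorm x := by
    rw [hA', Matrix.mul_assoc, ← Matrix.mulVec_mulVec, ← Matrix.mulVec_mulVec,
      vecNorm_isometry_mulVec (Matrix.mem_unitaryGroup_iff'.mp hU'), ← hVx',
      ← pow_le_pow_iff_left₀ (vecNorm_nonneg _) (mul_nonneg (h0' k) (vecNorm_nonneg _)) two_ne_zero,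
      hdiag, mul_pow, vecNorm_sq, Finset.mul_sum]
    refine Finset.sum_le_sum fun j _ => ?_
    rcases lt_or_ge (j : ℕ) k with hj | hj
    · simp [hx.2 j hj]
    · split_ifs
      · have := h0' j
        gcongr
        exact hd' hj
      · positivity
  have htri : vecNorm (A *ᵥ x) ≤ vecNorm ((A - A') *ᵥ x) + vecNorm (A' *ᵥ x) := by
    have := norm_add_le (WithLp.toLp 2 ((A - A') *ᵥ x)) (WithLp.toLp 2 (A' *ᵥ x))
    rwa [← WithLp.toLp_add, ← Matrix.add_mulVec, sub_add_cancel] at this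
  have := vecNorm_mulVec_le (A - A') x
  have : (d k - d' k) * vecNorm x ≤ √(frobSq (A - A')) * vecNorm x := by linarith
  exact le_of_mul_le_mul_right this hxpos

theorem singVal_antitone (A : Matrix (Fin m) (Fin n) 𝕜) : Antitone (singVal A) :=
  LinearMap.singularValues_antitone _

/-- Singular values are Lipschitz continuous with constant `1`. -/
theorem abs_singVal_sub_le (A A' : Matrix (Fin m) (Fin n) 𝕜) (i : Fin m) :
    |singVal A i - singVal A' i| ≤ distFrob A A' := by
  obtain ⟨U, V, hU, hV, hA⟩ := exists_isFullSVD A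
  obtain ⟨U', V', hU', hV', hA'⟩ := exists_isFullSVD A'
  rcases lt_or_ge (i : ℕ) n with hi | hi
  · have h1 := sub_le_sqrt_frobSq hU hV hU' hV' (singVal_antitone A) (singVal_antitone A')
      (singVal_nonneg A) (singVal_nonneg A') i.2 hi
    have h2 := sub_le_sqrt_frobSq hU' hV' hU hV (singVal_antitone A') (singVal_antitone A)
      (singVal_nonneg A') (singVal_nonneg A) i.2 hi
    simp only [diagRect_singVal, ← hA, ← hA'] at h1 h2
    rw [← distFrob_eq] at h1 h2
    have h3 : distFrob A' A = distFrob A A' := by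
      simp only [distFrob, norm_sub_rev]
    rw [h3] at h2
    exact abs_sub_le_iff.mpr ⟨h1, h2⟩
  · rw [singVal_of_le A hi, singVal_of_le A' hi, sub_zero, abs_zero]
    exact Real.sqrt_nonneg _

/-- Uniqueness of singular values: a factorization of `B` with the singular values of `A` in the
middle factor is a full singular value decomposition of `B`. -/
theorem isFullSVD_of_eq (A : Matrix (Fin m) (Fin n) 𝕜) {B : Matrix (Fin m) (Fin n) 𝕜}
    {U : Matrix (Fin m) (Fin m) 𝕜} {V : Matrix (Fin n) (Fin n) 𝕜}
    (hU : U ∈ Matrix.unitaryGroup (Fin m) 𝕜) (hV : V ∈ Matrix.unitaryGroup (Fin n) 𝕜)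
    (hB : B = U * sigmaHat A * Vᴴ) :
    (∀ i : Fin m, singVal B i = singVal A i) ∧ IsFullSVD B U V := by
  obtain ⟨U', V', hU', hV', hB'⟩ := exists_isFullSVD B
  have h : ∀ i : Fin m, singVal B i = singVal A i := by
    intro i
    rcases lt_or_ge (i : ℕ) n with hi | hi
    · have h1 := sub_le_sqrt_frobSq hU hV hU' hV' (singVal_antitone A) (singVal_antitone B)
        (singVal_nonneg A) (singVal_nonneg B) i.2 hi
      have h2 := sub_le_sqrt_frobSq hU' hV' hU hV (singVal_antitone B) (singVal_antitone A)
        (singVal_nonneg B) (singVal_nonneg A) i.2 hi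
      simp only [diagRect_singVal, ← hB, ← hB'] at h1 h2
      simp only [sub_self, frobSq, Matrix.zero_apply, norm_zero] at h1 h2
      norm_num at h1 h2
      exact le_antisymm h2 h1
    · rw [singVal_of_le A hi, singVal_of_le B hi]
  refine ⟨h, hU, hV, ?_⟩
  have hs : sigmaHat B = sigmaHat A := by
    ext i j
    simp only [sigmaHat, Matrix.of_apply, h i]
  rw [hs]
  exact hB

/-! ### Distances on the Grassmannian -/

theorem frobSq_eq_sum_singVal_sq {k : ℕ} (B : Matrix (Fin k) (Fin k) 𝕜) :
    frobSq B = ∑ i : Fin k, singVal B i ^ 2 := by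
  obtain ⟨U, V, hU, hV, hB⟩ := exists_isFullSVD B
  have h : frobSq B = frobSq (sigmaHat B) := by
    conv_lhs => rw [hB]
    rw [frobSq_mul_coisometry _ (by
        rw [Matrix.conjTranspose_conjTranspose]; exact Matrix.mem_unitaryGroup_iff'.mp hV),
      frobSq_isometry_mul (Matrix.mem_unitaryGroup_iff'.mp hU)]
  rw [h, frobSq]
  refine Finset.sum_congr rfl fun i _ => ?_
  rw [Finset.sum_eq_single i]
  · simp [sigmaHat]
  · intro j _ hj
    have : (i : ℕ) ≠ j := fun h => hj (Fin.ext h.symm)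
    simp [sigmaHat, this]
  · simp

/-- The cosines of principal angles are at most `1`: if `B = Qᴴ R`, then `1 - Bᴴ B = Cᴴ C` for
`C = (1 - Q Qᴴ) R`. -/
theorem singVal_le_one {k : ℕ} {Q R : Matrix (Fin p) (Fin k) 𝕜} (hQ : Qᴴ * Q = 1)
    (hR : Rᴴ * R = 1) (i : Fin k) : singVal (Qᴴ * R) i ≤ 1 := by
  obtain ⟨U, V, hU, hV, hB⟩ := exists_isFullSVD (Qᴴ * R)
  have hU1 : Uᴴ * U = 1 := Matrix.mem_unitaryGroup_iff'.mp hU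
  have hV1 : Vᴴ * V = 1 := Matrix.mem_unitaryGroup_iff'.mp hV
  set C := (R - Q * (Qᴴ * R)) * V with hC
  have h1 : Cᴴ * C = 1 - Matrix.diagonal fun i : Fin k =>
      ((singVal (Qᴴ * R) i : ℝ) : 𝕜) ^ 2 := by
    have e : (R - Q * (Qᴴ * R))ᴴ * (R - Q * (Qᴴ * R)) = 1 - (Qᴴ * R)ᴴ * (Qᴴ * R) := by
      rw [Matrix.conjTranspose_sub, Matrix.conjTranspose_mul Q, Matrix.sub_mul, Matrix.mul_sub,
        Matrix.mul_sub, hR]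
      have e1 : Rᴴ * (Q * (Qᴴ * R)) = (Qᴴ * R)ᴴ * (Qᴴ * R) := by
        simp [Matrix.conjTranspose_mul, Matrix.mul_assoc]
      have e2 : (Qᴴ * R)ᴴ * Qᴴ * (Q * (Qᴴ * R)) = (Qᴴ * R)ᴴ * (Qᴴ * R) := by
        rw [Matrix.mul_assoc, ← Matrix.mul_assoc Qᴴ Q, hQ, Matrix.one_mul]
      rw [e1, e2, Matrix.mul_assoc, sub_self, sub_zero]
    have e3 : (Qᴴ * R)ᴴ * (Qᴴ * R) =
        V * ((sigmaHat (Qᴴ * R))ᴴ * sigmaHat (Qᴴ * R)) * Vᴴ := by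
      conv_lhs => rw [hB]
      generalize sigmaHat (Qᴴ * R) = E
      simp only [Matrix.conjTranspose_mul, Matrix.conjTranspose_conjTranspose]
      calc V * (Eᴴ * Uᴴ) * (U * E * Vᴴ) = V * (Eᴴ * (Uᴴ * U) * E) * Vᴴ := by
            simp only [Matrix.mul_assoc]
        _ = _ := by rw [hU1, Matrix.mul_one]
    have e4 : (sigmaHat (Qᴴ * R))ᴴ * sigmaHat (Qᴴ * R) = Matrix.diagonal fun i : Fin k =>
        ((singVal (Qᴴ * R) i : ℝ) : 𝕜) ^ 2 := by
      rw [← sigmaHat_mul, ← diagRect_singVal, diagRect_conjTranspose]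
    rw [hC, Matrix.conjTranspose_mul, Matrix.mul_assoc, ← Matrix.mul_assoc _ _ V, e, e3, e4,
      Matrix.sub_mul, Matrix.one_mul, Matrix.mul_sub, hV1]
    congr 1
    generalize (Matrix.diagonal fun i : Fin k => ((singVal (Qᴴ * R) i : ℝ) : 𝕜) ^ 2) = D
    calc Vᴴ * (V * D * Vᴴ * V) = (Vᴴ * V) * D * (Vᴴ * V) := by simp only [Matrix.mul_assoc]
      _ = D := by rw [hV1, Matrix.one_mul, Matrix.mul_one]
  have h2 : (Cᴴ * C) i i = ((∑ a, ‖C a i‖ ^ 2 : ℝ) : 𝕜) := by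
    rw [Matrix.mul_apply]
    push_cast
    refine Finset.sum_congr rfl fun a _ => ?_
    rw [Matrix.conjTranspose_apply, RCLike.star_def, RCLike.conj_mul]
  have h3 : ∑ a, ‖C a i‖ ^ 2 = 1 - singVal (Qᴴ * R) i ^ 2 := by
    rw [h1] at h2
    simp only [Matrix.sub_apply, Matrix.one_apply_eq, Matrix.diagonal_apply_eq] at h2
    exact_mod_cast h2.symm
  have h4 : 0 ≤ ∑ a, ‖C a i‖ ^ 2 := by positivity
  nlinarith [singVal_nonneg (Qᴴ * R) i]

section Angle

variable {d : ℕ}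

theorem angle_nonneg (P P' : Gr 𝕜 d p) (i : Fin d) : 0 ≤ angle P P' i := Real.arccos_nonneg _

theorem angle_le_pi_div_two (P P' : Gr 𝕜 d p) (i : Fin d) : angle P P' i ≤ Real.pi / 2 :=
  Real.arccos_le_pi_div_two.mpr (singVal_nonneg _ _)

theorem sin_angle_nonneg (P P' : Gr 𝕜 d p) (i : Fin d) : 0 ≤ Real.sin (angle P P' i) :=
  Real.sin_nonneg_of_nonneg_of_le_pi (angle_nonneg P P' i) (Real.arccos_le_pi _)

theorem sin_angle_sq (P P' : Gr 𝕜 d p) (i : Fin d) :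
    Real.sin (angle P P' i) ^ 2 = 1 - singVal (P.frameᴴ * P'.frame) i ^ 2 := by
  rw [Real.sin_sq, angle, Real.cos_arccos (by linarith [singVal_nonneg (P.frameᴴ * P'.frame) i])
    (singVal_le_one P.frame_spec.1 P'.frame_spec.1 i)]

theorem distChordal_sq (P P' : Gr 𝕜 d p) :
    distChordal P P' ^ 2 = d - frobSq (P.frameᴴ * P'.frame) := by
  rw [distChordal, Real.sq_sqrt (by positivity), frobSq_eq_sum_singVal_sq]
  simp [sin_angle_sq]

theorem distChordal_nonneg (P P' : Gr 𝕜 d p) : 0 ≤ distChordal P P' := Real.sqrt_nonneg _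

theorem sin_le_two_mul_sin_half {θ : ℝ} (h0 : 0 ≤ θ) (h1 : θ ≤ Real.pi / 2) :
    Real.sin θ ≤ 2 * Real.sin (θ / 2) := by
  have hs : 0 ≤ Real.sin (θ / 2) :=
    Real.sin_nonneg_of_nonneg_of_le_pi (by linarith) (by linarith [Real.pi_pos])
  have h : Real.sin θ = 2 * Real.sin (θ / 2) * Real.cos (θ / 2) := by
    rw [← Real.sin_two_mul]; ring_nf
  rw [h]
  nlinarith [Real.cos_le_one (θ / 2)]

theorem distChordal_le_distProcrustes (P P' : Gr 𝕜 d p) :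
    distChordal P P' ≤ distProcrustes P P' := by
  refine Real.sqrt_le_sqrt (Finset.sum_le_sum fun i _ => ?_)
  have := sin_le_two_mul_sin_half (angle_nonneg P P' i) (angle_le_pi_div_two P P' i)
  exact pow_le_pow_left₀ (sin_angle_nonneg P P' i) this 2

theorem distProcrustes_le_distGrassmann (P P' : Gr 𝕜 d p) :
    distProcrustes P P' ≤ distGrassmann P P' := by
  refine Real.sqrt_le_sqrt (Finset.sum_le_sum fun i _ => ?_)
  have h0 := angle_nonneg P P' i
  have h1 := angle_le_pi_div_two P P' i
  refine pow_le_pow_left₀ ?_ ?_ 2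
  · have := Real.sin_nonneg_of_nonneg_of_le_pi (x := angle P P' i / 2) (by linarith)
      (by linarith [Real.pi_pos])
    linarith
  · linarith [Real.sin_le (x := angle P P' i / 2) (by linarith)]

/-- The Grassmann and the chordal distance agree to first order, as `θ cos θ ≤ sin θ` and every
`cos θ_i` is at least `√(1 - ∑ sin² θ_j)`. -/
theorem distGrassmann_mul_le (P P' : Gr 𝕜 d p) :
    distGrassmann P P' * √(1 - distChordal P P' ^ 2) ≤ distChordal P P' := by
  rw [distGrassmann, ← Real.sqrt_mul (by positivity), Finset.sum_mul]
  refine Real.sqrt_le_sqrt (Finset.sum_le_sum fun i _ => ?_)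
  have h0 := angle_nonneg P P' i
  have h1 := angle_le_pi_div_two P P' i
  have hc : 0 ≤ Real.cos (angle P P' i) := Real.cos_nonneg_of_mem_Icc ⟨by linarith, h1⟩
  have h2 : 1 - distChordal P P' ^ 2 ≤ Real.cos (angle P P' i) ^ 2 := by
    rw [distChordal, Real.sq_sqrt (by positivity), Real.cos_sq']
    have := Finset.single_le_sum (f := fun i => Real.sin (angle P P' i) ^ 2)
      (fun i _ => sq_nonneg _) (Finset.mem_univ i)
    linarith
  have h3 : angle P P' i * Real.cos (angle P P' i) ≤ Real.sin (angle P P' i) := by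
    rcases h1.eq_or_lt with h | h
    · rw [h]; simp
    · have := Real.le_tan h0 h
      rw [Real.tan_eq_sin_div_cos, le_div_iff₀ (Real.cos_pos_of_mem_Ioo ⟨by linarith, h⟩)] at this
      exact this
  calc _ ≤ angle P P' i ^ 2 * Real.cos (angle P P' i) ^ 2 := by gcongr
    _ = (angle P P' i * Real.cos (angle P P' i)) ^ 2 := by ring
    _ ≤ _ := pow_le_pow_left₀ (by positivity) h3 2

end Angle

/-! ### The chordal distance between spans of columns -/

theorem sum_norm_sq_row {W : Matrix (Fin m) (Fin m) 𝕜} (hW : W ∈ Matrix.unitaryGroup (Fin m) 𝕜)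
    (i : Fin m) : ∑ j, ‖W i j‖ ^ 2 = 1 := by
  have h : (W * Wᴴ) i i = 1 := by
    rw [show W * Wᴴ = 1 from Matrix.mem_unitaryGroup_iff.mp hW, Matrix.one_apply_eq]
  rw [Matrix.mul_apply] at h
  have h2 : ((∑ j, ‖W i j‖ ^ 2 : ℝ) : 𝕜) = ((1 : ℝ) : 𝕜) := by
    push_cast
    rw [← h]
    refine Finset.sum_congr rfl fun a _ => ?_
    rw [Matrix.conjTranspose_apply, RCLike.star_def, RCLike.mul_conj]
  exact_mod_cast h2

theorem conjTranspose_mem_unitaryGroup {W : Matrix (Fin m) (Fin m) 𝕜}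
    (hW : W ∈ Matrix.unitaryGroup (Fin m) 𝕜) : Wᴴ ∈ Matrix.unitaryGroup (Fin m) 𝕜 :=
  Unitary.star_mem hW

theorem sum_orderEmbOfFin (π : Finset (Fin m)) (f : Fin m → ℝ) :
    ∑ a, f (π.orderEmbOfFin rfl a) = ∑ i ∈ π, f i := by
  have := Finset.sum_map Finset.univ (π.orderEmbOfFin rfl).toEmbedding f
  rw [Finset.map_orderEmbOfFin_univ] at this
  exact this.symm

theorem distChordal_leftMap_sq {π : Finset (Fin m)} (A A' : domU 𝕜 m n π) {U V U' V'}
    (h : IsFullSVD A.1 U V) (h' : IsFullSVD A'.1 U' V') :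
    distChordal (leftMap π A) (leftMap π A') ^ 2 =
      ∑ i ∈ π, ∑ j ∈ πᶜ, ‖(Uᴴ * U') i j‖ ^ 2 := by
  have hW : Uᴴ * U' ∈ Matrix.unitaryGroup (Fin m) 𝕜 :=
    mul_mem (conjTranspose_mem_unitaryGroup h.1) h'.1
  rw [distChordal_sq, frobSq_conjTranspose_mul_congr (Q' := selCols U π) (R' := selCols U' π)]
  · have h1 : frobSq ((selCols U π)ᴴ * selCols U' π) =
        ∑ i ∈ π, ∑ j ∈ π, ‖(Uᴴ * U') i j‖ ^ 2 := by
      rw [← sum_orderEmbOfFin]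
      simp only [← sum_orderEmbOfFin π (fun j => ‖(Uᴴ * U') _ j‖ ^ 2)]
      rfl
    have h2 : (π.card : ℝ) = ∑ i ∈ π, ∑ j, ‖(Uᴴ * U') i j‖ ^ 2 := by
      simp [sum_norm_sq_row hW]
    rw [h1, h2, ← Finset.sum_sub_distrib]
    refine Finset.sum_congr rfl fun i _ => ?_
    rw [← Finset.sum_add_sum_compl π, add_sub_cancel_left]
  · rw [← (leftMap π A).frame_spec.2, leftMap_eq π A h]
  · rw [← (leftMap π A').frame_spec.2, leftMap_eq π A' h']

/-- The two off-diagonal blocks of a unitary matrix have the same Frobenius norm. -/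
theorem sum_offDiag_block_comm {W : Matrix (Fin m) (Fin m) 𝕜}
    (hW : W ∈ Matrix.unitaryGroup (Fin m) 𝕜) (π : Finset (Fin m)) :
    ∑ i ∈ π, ∑ j ∈ πᶜ, ‖W i j‖ ^ 2 = ∑ i ∈ πᶜ, ∑ j ∈ π, ‖W i j‖ ^ 2 := by
  have h1 : ∑ i ∈ π, ∑ j, ‖W i j‖ ^ 2 = ∑ j ∈ π, ∑ i, ‖W i j‖ ^ 2 := by
    have := fun j => sum_norm_sq_row (conjTranspose_mem_unitaryGroup hW) j
    simp only [Matrix.conjTranspose_apply, norm_star] at this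
    simp [sum_norm_sq_row hW, this]
  have h2 : ∑ i ∈ π, ∑ j, ‖W i j‖ ^ 2 =
      ∑ i ∈ π, ∑ j ∈ π, ‖W i j‖ ^ 2 + ∑ i ∈ π, ∑ j ∈ πᶜ, ‖W i j‖ ^ 2 := by
    simp only [← Finset.sum_add_distrib, Finset.sum_add_sum_compl]
  have h3 : ∑ j ∈ π, ∑ i, ‖W i j‖ ^ 2 =
      ∑ j ∈ π, ∑ i ∈ π, ‖W i j‖ ^ 2 + ∑ j ∈ π, ∑ i ∈ πᶜ, ‖W i j‖ ^ 2 := by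
    simp only [← Finset.sum_add_distrib, Finset.sum_add_sum_compl]
  rw [Finset.sum_comm (s := π) (t := π), Finset.sum_comm (s := π) (t := πᶜ)] at h3
  linarith

/-! ### A perturbation bound for singular subspaces -/

/-- Extension of the rows of a matrix by zero. It makes it possible to index the entries of
`Uᴴ (A - A') V'` by the same pairs in `Fin m × Fin m` as those of `Uᴴ U'`. -/
def rowExt (M : Matrix (Fin m) (Fin n) 𝕜) (i : Fin m) (j : ℕ) : 𝕜 :=
  if h : j < n then M i ⟨j, h⟩ else 0

theorem sum_norm_sq_rowExt_le (M : Matrix (Fin m) (Fin n) 𝕜) :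
    ∑ i : Fin m, ∑ j : Fin m, ‖rowExt M i j‖ ^ 2 ≤ frobSq M := by
  refine Finset.sum_le_sum fun i _ => ?_
  have h1 : ∑ j : Fin n, ‖M i j‖ ^ 2 = ∑ j ∈ Finset.range n, ‖rowExt M i j‖ ^ 2 := by
    rw [← Fin.sum_univ_eq_sum_range (fun j => ‖rowExt M i j‖ ^ 2)]
    simp [rowExt]
  rw [h1, Fin.sum_univ_eq_sum_range (fun j => ‖rowExt M i j‖ ^ 2)]
  have h2 : ∑ j ∈ Finset.range n, ‖rowExt M i j‖ ^ 2 =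
      ∑ j ∈ Finset.range (n + m), ‖rowExt M i j‖ ^ 2 := by
    refine Finset.sum_subset (Finset.range_mono (Nat.le_add_right n m)) fun j _ hj => ?_
    rw [Finset.mem_range] at hj
    simp [rowExt, hj]
  rw [h2]
  exact Finset.sum_le_sum_of_subset_of_nonneg (Finset.range_mono (Nat.le_add_left m n))
    fun _ _ _ => by positivity

/-- With `W = Uᴴ U'`, `F = Uᴴ (A - A') V'` and `G = U'ᴴ (A - A') V`, this is the `(i, j)` entry of
`Σ Σᵀ W - W Σ' Σ'ᵀ = F Σ'ᵀ + Σ Gᴴ`. -/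
theorem sylvester_entry {A A' : Matrix (Fin m) (Fin n) 𝕜} {U V U' V'} (h : IsFullSVD A U V)
    (h' : IsFullSVD A' U' V') (i j : Fin m) :
    (((singVal A i ^ 2 - singVal A' j ^ 2 : ℝ)) : 𝕜) * (Uᴴ * U') i j =
      rowExt (Uᴴ * (A - A') * V') i j * (singVal A' j : 𝕜) +
        (singVal A i : 𝕜) * star (rowExt (U'ᴴ * (A - A') * V) j i) := by
  obtain ⟨hU, hV, hA⟩ := h
  obtain ⟨hU', hV', hA'⟩ := h'
  have hU1 : Uᴴ * U = 1 := Matrix.mem_unitaryGroup_iff'.mp hU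
  have hU1' : U'ᴴ * U' = 1 := Matrix.mem_unitaryGroup_iff'.mp hU'
  have hV1 : Vᴴ * V = 1 := Matrix.mem_unitaryGroup_iff'.mp hV
  have hV1' : V'ᴴ * V' = 1 := Matrix.mem_unitaryGroup_iff'.mp hV'
  have hAV : Uᴴ * A = sigmaHat A * Vᴴ := by
    conv_lhs => rw [hA]
    rw [← Matrix.mul_assoc, ← Matrix.mul_assoc, hU1, Matrix.one_mul]
  have hAV' : U'ᴴ * A' = sigmaHat A' * V'ᴴ := by
    conv_lhs => rw [hA']
    rw [← Matrix.mul_assoc, ← Matrix.mul_assoc, hU1', Matrix.one_mul]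
  have hAU : A * V = U * sigmaHat A := by
    conv_lhs => rw [hA]
    rw [Matrix.mul_assoc, hV1, Matrix.mul_one]
  have hAU' : A' * V' = U' * sigmaHat A' := by
    conv_lhs => rw [hA']
    rw [Matrix.mul_assoc, hV1', Matrix.mul_one]
  set F := Uᴴ * (A - A') * V' with hF
  set G := U'ᴴ * (A - A') * V with hG
  have key : sigmaHat A * (sigmaHat A)ᴴ * (Uᴴ * U') -
      Uᴴ * U' * (sigmaHat A' * (sigmaHat A')ᴴ) =
      F * (sigmaHat A')ᴴ + sigmaHat A * Gᴴ := by
    have h1 : F = sigmaHat A * (Vᴴ * V') - Uᴴ * U' * sigmaHat A' := by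
      rw [hF, Matrix.mul_sub, Matrix.sub_mul, hAV, Matrix.mul_assoc Uᴴ A' V', hAU',
        Matrix.mul_assoc, Matrix.mul_assoc]
    have h2 : G = U'ᴴ * U * sigmaHat A - sigmaHat A' * (V'ᴴ * V) := by
      rw [hG, Matrix.mul_sub, Matrix.sub_mul, hAV', Matrix.mul_assoc U'ᴴ A V, hAU,
        Matrix.mul_assoc, Matrix.mul_assoc]
    rw [h1, h2]
    simp only [Matrix.conjTranspose_sub, Matrix.conjTranspose_mul,
      Matrix.conjTranspose_conjTranspose, Matrix.mul_sub, Matrix.sub_mul, Matrix.mul_assoc]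
    abel
  have e := congrFun (congrFun key i) j
  rw [Matrix.sub_apply, sigmaHat_mul, sigmaHat_mul, Matrix.diagonal_mul, Matrix.mul_diagonal,
    Matrix.add_apply, ← diagRect_singVal, ← diagRect_singVal, diagRect_conjTranspose,
    mul_diagRect_apply, diagRect_mul_apply] at e
  have eF : (if h : (j : ℕ) < n then F i ⟨j, h⟩ * ((singVal A' j : ℝ) : 𝕜) else 0) =
      rowExt F i j * (singVal A' j : 𝕜) := by
    unfold rowExt; split_ifs <;> simp
  have eG : (if h : (i : ℕ) < n then ((singVal A i : ℝ) : 𝕜) * Gᴴ ⟨i, h⟩ j else 0) =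
      (singVal A i : 𝕜) * star (rowExt G j i) := by
    unfold rowExt; split_ifs <;> simp
  rw [eF, eG] at e
  rw [← e]
  push_cast
  ring

/-- If all pairs of singular values separated by `π` satisfy the gap condition with constant `C`,
then the chordal distance of the singular subspaces is at most `C ‖A - A'‖_F`. Both off-diagonal
blocks of `W` are summed: each of `F` and `G` is then used once, which gives the sharp constant. -/
theorem distChordal_leftMap_le {π : Finset (Fin m)} (A A' : domU 𝕜 m n π) {C : ℝ} (hC : 0 ≤ C)
    (hgap : ∀ i j : Fin m, (i ∈ π ↔ j ∉ π) → singVal A.1 i ^ 2 - singVal A'.1 j ^ 2 ≠ 0 ∧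
      singVal A.1 i ^ 2 + singVal A'.1 j ^ 2 ≤
        C ^ 2 * (singVal A.1 i ^ 2 - singVal A'.1 j ^ 2) ^ 2) :
    distChordal (leftMap π A) (leftMap π A') ≤ C * distFrob A.1 A'.1 := by
  obtain ⟨U, V, h⟩ := exists_isFullSVD A.1
  obtain ⟨U', V', h'⟩ := exists_isFullSVD A'.1
  have hW : Uᴴ * U' ∈ Matrix.unitaryGroup (Fin m) 𝕜 :=
    mul_mem (conjTranspose_mem_unitaryGroup h.1) h'.1
  set W := Uᴴ * U'
  set F := Uᴴ * (A.1 - A'.1) * V' with hF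
  set G := U'ᴴ * (A.1 - A'.1) * V with hG
  have hFn : frobSq F = frobSq (A.1 - A'.1) := by
    rw [hF, frobSq_mul_coisometry _ (Matrix.mem_unitaryGroup_iff.mp h'.2.1),
      frobSq_isometry_mul]
    rw [Matrix.conjTranspose_conjTranspose]; exact Matrix.mem_unitaryGroup_iff.mp h.1
  have hGn : frobSq G = frobSq (A.1 - A'.1) := by
    rw [hG, frobSq_mul_coisometry _ (Matrix.mem_unitaryGroup_iff.mp h.2.1),
      frobSq_isometry_mul]
    rw [Matrix.conjTranspose_conjTranspose]; exact Matrix.mem_unitaryGroup_iff.mp h'.1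
  have hentry : ∀ i j : Fin m, (i ∈ π ↔ j ∉ π) →
      ‖W i j‖ ^ 2 ≤ C ^ 2 * (‖rowExt F i j‖ ^ 2 + ‖rowExt G j i‖ ^ 2) := by
    intro i j hij
    obtain ⟨hne, hle⟩ := hgap i j hij
    have e := congrArg norm (sylvester_entry h h' i j)
    rw [norm_mul, RCLike.norm_ofReal] at e
    have e2 : |singVal A.1 i ^ 2 - singVal A'.1 j ^ 2| * ‖W i j‖ ≤
        ‖rowExt F i j‖ * singVal A'.1 j + singVal A.1 i * ‖rowExt G j i‖ := by
      rw [e]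
      refine (norm_add_le _ _).trans_eq ?_
      rw [norm_mul, norm_mul, norm_star, RCLike.norm_ofReal, RCLike.norm_ofReal,
        abs_of_nonneg (singVal_nonneg _ _), abs_of_nonneg (singVal_nonneg _ _)]
    have e3 := pow_le_pow_left₀ (by positivity) e2 2
    rw [mul_pow, sq_abs] at e3
    have hpos : 0 < (singVal A.1 i ^ 2 - singVal A'.1 j ^ 2) ^ 2 := by positivity
    refine le_of_mul_le_mul_left ?_ hpos
    refine e3.trans ?_
    calc _ ≤ (singVal A.1 i ^ 2 + singVal A'.1 j ^ 2) *
          (‖rowExt F i j‖ ^ 2 + ‖rowExt G j i‖ ^ 2) := by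
            nlinarith [sq_nonneg (‖rowExt F i j‖ * singVal A.1 i -
              singVal A'.1 j * ‖rowExt G j i‖)]
      _ ≤ (C ^ 2 * (singVal A.1 i ^ 2 - singVal A'.1 j ^ 2) ^ 2) *
          (‖rowExt F i j‖ ^ 2 + ‖rowExt G j i‖ ^ 2) := by gcongr
      _ = _ := by ring
  have hsum : 2 * distChordal (leftMap π A) (leftMap π A') ^ 2 =
      ∑ i, ∑ j, if (i ∈ π ↔ j ∉ π) then ‖W i j‖ ^ 2 else 0 := by
    have e := distChordal_leftMap_sq A A' h h'
    have e' := e.trans (sum_offDiag_block_comm hW π)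
    rw [two_mul]
    nth_rw 1 [e]
    rw [e', ← Finset.sum_add_sum_compl π]
    congr 1
    · refine Finset.sum_congr rfl fun i hi => ?_
      rw [← Finset.sum_filter]
      refine Finset.sum_congr ?_ fun _ _ => rfl
      ext j; simp [hi]
    · refine Finset.sum_congr rfl fun i hi => ?_
      rw [← Finset.sum_filter]
      refine Finset.sum_congr ?_ fun _ _ => rfl
      ext j; simp [Finset.mem_compl.mp hi]
  have hle : 2 * distChordal (leftMap π A) (leftMap π A') ^ 2 ≤
      C ^ 2 * (2 * frobSq (A.1 - A'.1)) := by
    rw [hsum]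
    calc _ ≤ ∑ i : Fin m, ∑ j : Fin m, C ^ 2 * (‖rowExt F i j‖ ^ 2 + ‖rowExt G j i‖ ^ 2) := by
          refine Finset.sum_le_sum fun i _ => Finset.sum_le_sum fun j _ => ?_
          split_ifs with hij
          · exact hentry i j hij
          · positivity
      _ = C ^ 2 * (∑ i : Fin m, ∑ j : Fin m, ‖rowExt F i j‖ ^ 2 +
            ∑ i : Fin m, ∑ j : Fin m, ‖rowExt G i j‖ ^ 2) := by
          simp only [← Finset.mul_sum, Finset.sum_add_distrib]
          rw [Finset.sum_comm (f := fun i j : Fin m => ‖rowExt G j i‖ ^ 2)]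
      _ ≤ C ^ 2 * (2 * frobSq (A.1 - A'.1)) := by
          have h1 := sum_norm_sq_rowExt_le F
          have h2 := sum_norm_sq_rowExt_le G
          rw [hFn] at h1
          rw [hGn] at h2
          gcongr
          linarith
  rw [distFrob_eq]
  refine le_of_sq_le_sq ?_ (by positivity)
  rw [mul_pow, Real.sq_sqrt (frobSq_nonneg _)]
  linarith

/-! ### The upper bound for the condition number -/

theorem pairCond_eq {s t : ℝ} (hs : 0 ≤ s) (ht : 0 ≤ t) (hst : s ≠ t) :
    pairCond s t = ENNReal.ofReal (√(s ^ 2 + t ^ 2) / |s ^ 2 - t ^ 2|) := by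
  have hpos : 0 < s + t := by
    rcases hs.eq_or_lt with rfl | h
    · have := lt_of_le_of_ne ht hst; linarith
    · linarith
  rw [pairCond, if_neg hst, Real.sqrt_div (by positivity), Real.sqrt_sq hpos.le,
    show s ^ 2 - t ^ 2 = (s - t) * (s + t) by ring, abs_mul, abs_of_pos hpos]
  congr 1
  field_simp

theorem pairCond_comm (s t : ℝ) : pairCond s t = pairCond t s := by
  unfold pairCond
  by_cases h : s = t
  · simp [h]
  · rw [if_neg h, if_neg (Ne.symm h), abs_sub_comm, add_comm, add_comm s]

theorem sq_sub_sq_ne_zero {s t : ℝ} (hs : 0 ≤ s) (ht : 0 ≤ t) (hst : s ≠ t) :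
    s ^ 2 - t ^ 2 ≠ 0 := fun h =>
  hst ((pow_left_inj₀ hs ht two_ne_zero).mp (sub_eq_zero.mp h))

/-- The bound by `pairCond` persists for nearby values of the second singular value. -/
theorem eventually_gap {s t C : ℝ} (hs : 0 ≤ s) (ht : 0 ≤ t)
    (h : pairCond s t < ENNReal.ofReal C) :
    ∀ᶠ ε in 𝓝[>] (0 : ℝ), ∀ t', |t - t'| ≤ ε →
      s ^ 2 - t' ^ 2 ≠ 0 ∧ s ^ 2 + t' ^ 2 ≤ C ^ 2 * (s ^ 2 - t' ^ 2) ^ 2 := by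
  have hst : s ≠ t := by
    rintro rfl
    simp [pairCond] at h
  have hne := sq_sub_sq_ne_zero hs ht hst
  rw [pairCond_eq hs ht hst, ENNReal.ofReal_lt_ofReal_iff_of_nonneg (by positivity),
    div_lt_iff₀ (abs_pos.mpr hne)] at h
  have h2 : s ^ 2 + t ^ 2 < C ^ 2 * (s ^ 2 - t ^ 2) ^ 2 := by
    have := pow_lt_pow_left₀ h (Real.sqrt_nonneg _) two_ne_zero
    rwa [Real.sq_sqrt (by positivity), mul_pow, sq_abs] at this
  have e1 : ∀ᶠ t' in 𝓝 t, s ^ 2 - t' ^ 2 ≠ 0 :=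
    ContinuousAt.eventually_ne (by fun_prop) hne
  have e2 : ∀ᶠ t' in 𝓝 t, s ^ 2 + t' ^ 2 < C ^ 2 * (s ^ 2 - t' ^ 2) ^ 2 :=
    ContinuousAt.eventually_lt (by fun_prop) (by fun_prop) h2
  obtain ⟨δ, hδ, hball⟩ := Metric.eventually_nhds_iff.mp (e1.and e2)
  filter_upwards [Ioo_mem_nhdsGT hδ] with ε hε t' ht'
  have := hball (y := t') (by rw [Real.dist_eq, abs_sub_comm]; exact ht'.trans_lt hε.2)
  exact ⟨this.1, this.2.le⟩

/-- Upper bound for every distance that agrees with the chordal distance to first order. -/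
theorem riceCond_le {π : Finset (Fin m)} {dGr : Gr 𝕜 π.card m → Gr 𝕜 π.card m → ℝ}
    (hd : ∀ P P', dGr P P' * √(1 - distChordal P P' ^ 2) ≤ distChordal P P')
    (A : domU 𝕜 m n π) :
    riceCond (fun B B' : domU 𝕜 m n π => distFrob B.1 B'.1) dGr (leftMap π) A ≤
      maxPairCond π A.1 := by
  refine le_of_forall_gt_imp_ge_of_dense fun c hc => ?_
  obtain ⟨c', hc1, hc2⟩ := exists_between hc
  rcases eq_or_ne c ⊤ with rfl | hctop
  · exact le_top
  set C := c.toReal with hCdef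
  set C' := c'.toReal with hCdef'
  have hc'top : c' ≠ ⊤ := ne_top_of_lt hc2
  have hC : ENNReal.ofReal C = c := ENNReal.ofReal_toReal hctop
  have hC' : ENNReal.ofReal C' = c' := ENNReal.ofReal_toReal hc'top
  have hC0' : 0 ≤ C' := ENNReal.toReal_nonneg
  have hlt : C' < C := (ENNReal.toReal_lt_toReal hc'top hctop).mpr hc2
  have hgap : ∀ᶠ ε in 𝓝[>] (0 : ℝ), ∀ i j : Fin m, (i ∈ π ↔ j ∉ π) →
      ∀ t', |singVal A.1 j - t'| ≤ ε → singVal A.1 i ^ 2 - t' ^ 2 ≠ 0 ∧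
        singVal A.1 i ^ 2 + t' ^ 2 ≤ C' ^ 2 * (singVal A.1 i ^ 2 - t' ^ 2) ^ 2 := by
    rw [Filter.eventually_all]
    intro i
    rw [Filter.eventually_all]
    intro j
    by_cases hij : i ∈ π ↔ j ∉ π
    · have hlt' : pairCond (singVal A.1 i) (singVal A.1 j) < ENNReal.ofReal C' := by
        rw [hC']
        refine lt_of_le_of_lt ?_ hc1
        by_cases hi : i ∈ π
        · exact le_iSup₂_of_le i hi
            (le_iSup₂_of_le j (Finset.mem_compl.mpr (hij.mp hi)) le_rfl)
        · have hj : j ∈ π := by tauto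
          rw [pairCond_comm]
          exact le_iSup₂_of_le j hj (le_iSup₂_of_le i (Finset.mem_compl.mpr hi) le_rfl)
      filter_upwards [eventually_gap (singVal_nonneg _ _) (singVal_nonneg _ _) hlt'] with ε hε _
      exact hε
    · exact Filter.Eventually.of_forall fun _ h => absurd h hij
  have hsmall : ∀ᶠ ε in 𝓝[>] (0 : ℝ), C' < C * √(1 - (C' * ε) ^ 2) := by
    have : ContinuousAt (fun ε : ℝ => C * √(1 - (C' * ε) ^ 2)) 0 := by fun_prop
    refine (this.eventually_const_lt ?_).filter_mono nhdsWithin_le_nhds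
    simpa using hlt
  obtain ⟨ε, ⟨hε1, hε2⟩, hε0⟩ := ((hgap.and hsmall).and self_mem_nhdsWithin).exists
  refine iInf₂_le_of_le ε hε0 (iSup₂_le fun A' hA' => ?_)
  rw [← hC]
  refine ENNReal.ofReal_le_ofReal ?_
  have hdε : distFrob A.1 A'.1 ≤ ε := hA'.2
  have hd0 : 0 ≤ distFrob A.1 A'.1 := Real.sqrt_nonneg _
  have hch : distChordal (leftMap π A) (leftMap π A') ≤ C' * distFrob A.1 A'.1 :=
    distChordal_leftMap_le A A' hC0' fun i j hij =>
      hε1 i j hij _ ((abs_singVal_sub_le _ _ _).trans hdε)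
  have hC0 : 0 ≤ C := ENNReal.toReal_nonneg
  refine div_le_of_le_mul₀ hd0 hC0 ?_
  have hr : √(1 - (C' * ε) ^ 2) ≤ √(1 - distChordal (leftMap π A) (leftMap π A') ^ 2) := by
    refine Real.sqrt_le_sqrt (sub_le_sub_left ?_ _)
    exact pow_le_pow_left₀ (distChordal_nonneg _ _)
      (hch.trans (mul_le_mul_of_nonneg_left hdε hC0')) 2
  have hrpos : 0 < √(1 - distChordal (leftMap π A) (leftMap π A') ^ 2) := by
    by_contra h
    have h0 : √(1 - (C' * ε) ^ 2) = 0 :=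
      le_antisymm (hr.trans (not_lt.mp h)) (Real.sqrt_nonneg _)
    rw [h0, mul_zero] at hε2
    linarith
  refine le_of_mul_le_mul_right ?_ hrpos
  calc _ ≤ distChordal (leftMap π A) (leftMap π A') := hd _ _
    _ ≤ C' * distFrob A.1 A'.1 := hch
    _ ≤ C * √(1 - (C' * ε) ^ 2) * distFrob A.1 A'.1 := by gcongr
    _ ≤ C * √(1 - distChordal (leftMap π A) (leftMap π A') ^ 2) * distFrob A.1 A'.1 := by gcongr
    _ = _ := by ring

/-! ### The domain of the singular subspace map -/

theorem mem_domU_iff {π : Finset (Fin m)} {A : Matrix (Fin m) (Fin n) 𝕜} :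
    A ∈ domU 𝕜 m n π ↔ ∀ i ∈ π, ∀ j ∉ π, singVal A i ≠ singVal A j := by
  constructor
  · rintro ⟨U, V, h, S, hS, hW⟩ i hi j hj hij
    have hS0 : ∀ s ∈ S, 0 ≤ s := by
      intro s hs
      rcases hS hs with rfl | ⟨i, rfl⟩
      · exact le_rfl
      · exact singVal_nonneg A i
    rw [iSup_basicLeftSubspace_eq h hS0] at hW
    have aux : ∀ (T : Set (Fin m)) (i : Fin m),
        U.col i ∈ Submodule.span 𝕜 (U.col '' T) → i ∈ T := by
      intro T i hi
      by_contra hiT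
      have := (mem_span_col_iff h.1 T _).mp hi i hiT
      rw [conjTranspose_mulVec_col h.1, if_pos rfl] at this
      exact one_ne_zero this
    have hiS : singVal A i ∈ S := by
      refine aux {i : Fin m | singVal A i ∈ S} i ?_
      rw [← hW]
      exact Submodule.subset_span ⟨i, hi, rfl⟩
    refine hj (aux (π : Set (Fin m)) j ?_)
    change U.col j ∈ colSpan U π
    rw [hW]
    refine Submodule.subset_span ⟨j, ?_, rfl⟩
    change singVal A j ∈ S
    rwa [← hij]
  · intro hA
    obtain ⟨U, V, h⟩ := exists_isFullSVD A
    refine ⟨U, V, h, (fun i : Fin m => singVal A i) '' π, ?_, ?_⟩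
    · rintro _ ⟨i, -, rfl⟩
      exact Or.inr ⟨i, rfl⟩
    · rw [iSup_basicLeftSubspace_eq h, colSpan]
      · congr 2
        ext i
        constructor
        · intro hi
          exact ⟨i, hi, rfl⟩
        · rintro ⟨k, hk, hki⟩
          by_contra hi
          exact hA k hk i hi hki
      · rintro _ ⟨i, -, rfl⟩
        exact singVal_nonneg A i

theorem maxPairCond_of_notMem {π : Finset (Fin m)} {A : Matrix (Fin m) (Fin n) 𝕜}
    (hA : A ∉ domU 𝕜 m n π) : maxPairCond π A = ⊤ := by
  rw [mem_domU_iff] at hA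
  push Not at hA
  obtain ⟨i, hi, j, hj, hij⟩ := hA
  refine top_le_iff.mp (le_iSup₂_of_le i hi
    (le_iSup₂_of_le j (Finset.mem_compl.mpr hj) ?_))
  rw [pairCond, if_pos hij]

/-! ### Plane rotations and the lower bound -/

/-- The entries of the rotation with cosine `c` and sine `s` in the plane of the coordinates
`i` and `j`. The indices are natural numbers, so that the same entries can be used for matrices of
sizes `m` and `n`. -/
def rotEntry (i j : ℕ) (c s : ℝ) (k l : ℕ) : ℝ :=
  if k = i ∧ l = i then c else if k = j ∧ l = j then c else if k = i ∧ l = j then -s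
  else if k = j ∧ l = i then s else if k = l then 1 else 0

/-- The plane rotation with the entries `rotEntry`. -/
def planeRot (𝕜 : Type*) [RCLike 𝕜] (p i j : ℕ) (c s : ℝ) : Matrix (Fin p) (Fin p) 𝕜 :=
  Matrix.of fun k l => ((rotEntry i j c s k l : ℝ) : 𝕜)

theorem planeRot_one_zero (i j : ℕ) : planeRot 𝕜 p i j 1 0 = 1 := by
  ext k l
  rw [Matrix.one_apply]
  simp only [planeRot, Matrix.of_apply, rotEntry, Fin.ext_iff]
  split_ifs <;> first | omega | simp

theorem planeRot_mem_unitaryGroup {i j : ℕ} (hi : i < p) (hj : j < p) (hij : i ≠ j) {c s : ℝ}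
    (hcs : c ^ 2 + s ^ 2 = 1) : planeRot 𝕜 p i j c s ∈ Matrix.unitaryGroup (Fin p) 𝕜 := by
  rw [Matrix.mem_unitaryGroup_iff]
  have key : ∀ k l : Fin p, ∑ q : Fin p, rotEntry i j c s k q * rotEntry i j c s l q =
      if k = l then 1 else 0 := by
    intro k l
    by_cases hk : (k : ℕ) = i ∨ (k : ℕ) = j
    · rw [Finset.sum_eq_add (⟨i, hi⟩ : Fin p) ⟨j, hj⟩]
      · simp only [rotEntry, Fin.ext_iff]
        grind
      · simpa [Fin.ext_iff] using hij
      · rintro q - ⟨h1, h2⟩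
        rw [Ne, Fin.ext_iff] at h1 h2
        simp only [rotEntry]
        grind
      · simp
      · simp
    · rw [Finset.sum_eq_single k]
      · simp only [rotEntry, Fin.ext_iff]
        grind
      · intro q _ hq
        rw [Ne, Fin.ext_iff] at hq
        simp only [rotEntry]
        grind
      · simp
  ext k l
  rw [Matrix.mul_apply, Matrix.one_apply]
  simp only [planeRot, Matrix.star_apply, Matrix.of_apply, RCLike.star_def, RCLike.conj_ofReal]
  have := congrArg (fun x : ℝ => (x : 𝕜)) (key k l)
  push_cast at this
  rw [this]
  split_ifs <;> simp

theorem planeRot_mul_diagRect_sub_apply {i j : ℕ} (hi : i < m) (hj : j < m) {c s c' s' : ℝ}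
    {d : ℕ → ℝ} (hd : ∀ k, n ≤ k → d k = 0)
    (k : Fin m) (l : Fin n) :
    (diagRect 𝕜 m n d * planeRot 𝕜 n i j c' s' - planeRot 𝕜 m i j c s * diagRect 𝕜 m n d) k l =
      ((d k * rotEntry i j c' s' k l - rotEntry i j c s k l * d l : ℝ) : 𝕜) := by
  rw [Matrix.sub_apply, diagRect_mul_apply, mul_diagRect_apply]
  have h1 : (if h : (k : ℕ) < n then ((d k : ℝ) : 𝕜) * planeRot 𝕜 n i j c' s' ⟨k, h⟩ l else 0) =
      ((d k * rotEntry i j c' s' k l : ℝ) : 𝕜) := by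
    split_ifs with hk
    · simp [planeRot]
    · simp [hd k (not_lt.mp hk)]
  have h2 : (if h : (l : ℕ) < m then planeRot 𝕜 m i j c s k ⟨l, h⟩ * ((d l : ℝ) : 𝕜) else 0) =
      ((rotEntry i j c s k l * d l : ℝ) : 𝕜) := by
    split_ifs with hl
    · simp [planeRot]
    · have : rotEntry i j c s k l = 0 := by
        have := k.2
        simp only [rotEntry]
        grind
      simp [this]
  rw [h1, h2]
  push_cast
  rfl

/-- Only the four entries in the rotation plane contribute to `Σ S - R Σ`. -/
theorem frobSq_diagRect_rot_le {i j : ℕ} (hi : i < m) (hj : j < m) (hij : i ≠ j)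
    {c s c' s' : ℝ} {d : ℕ → ℝ} (hd : ∀ k, n ≤ k → d k = 0) :
    frobSq (diagRect 𝕜 m n d * planeRot 𝕜 n i j c' s' - planeRot 𝕜 m i j c s * diagRect 𝕜 m n d) ≤
      (d i ^ 2 + d j ^ 2) * (c' - c) ^ 2 + (d i * s' - d j * s) ^ 2 +
        (d j * s' - d i * s) ^ 2 := by
  have hsum : ∀ (a b : ℕ) (x : ℝ), 0 ≤ x →
      ∑ k : Fin m, ∑ l : Fin n, (if (k : ℕ) = a ∧ (l : ℕ) = b then x else 0) ≤ x := by
    intro a b x hx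
    have h1 : ∀ (q b : ℕ) (y : ℝ), 0 ≤ y →
        ∑ l : Fin q, (if (l : ℕ) = b then y else 0) ≤ y := by
      intro q b y hy
      rw [Fin.sum_univ_eq_sum_range (fun l => if l = b then y else 0), Finset.sum_ite_eq']
      split_ifs <;> simp [hy]
    refine le_trans (Finset.sum_le_sum fun k _ => ?_) (h1 m a x hx)
    by_cases hk : (k : ℕ) = a
    · simpa [hk] using h1 n b x hx
    · simp [hk]
  have hentry : ∀ (k : Fin m) (l : Fin n),
      ‖(diagRect 𝕜 m n d * planeRot 𝕜 n i j c' s' -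
        planeRot 𝕜 m i j c s * diagRect 𝕜 m n d) k l‖ ^ 2 =
      (if (k : ℕ) = i ∧ (l : ℕ) = i then d i ^ 2 * (c' - c) ^ 2 else 0) +
      (if (k : ℕ) = j ∧ (l : ℕ) = j then d j ^ 2 * (c' - c) ^ 2 else 0) +
      (if (k : ℕ) = i ∧ (l : ℕ) = j then (d i * s' - d j * s) ^ 2 else 0) +
      (if (k : ℕ) = j ∧ (l : ℕ) = i then (d j * s' - d i * s) ^ 2 else 0) := by
    intro k l
    rw [planeRot_mul_diagRect_sub_apply hi hj hd, RCLike.norm_ofReal, sq_abs]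
    simp only [rotEntry]
    grind
  unfold frobSq
  simp only [hentry, Finset.sum_add_distrib]
  have h1 := hsum i i (d i ^ 2 * (c' - c) ^ 2) (by positivity)
  have h2 := hsum j j (d j ^ 2 * (c' - c) ^ 2) (by positivity)
  have h3 := hsum i j ((d i * s' - d j * s) ^ 2) (by positivity)
  have h4 := hsum j i ((d j * s' - d i * s) ^ 2) (by positivity)
  linarith

/-- Rotating the left singular vectors `i`, `j` by an angle with sine `x`, and the right singular
vectors by an angle with sine `2 σ_i σ_j / (σ_i ^ 2 + σ_j ^ 2) * x`, which is optimal to first order,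
moves the singular subspace by `x`. -/
theorem exists_rotated {π : Finset (Fin m)} (A : domU 𝕜 m n π) {i j : Fin m} (hi : i ∈ π)
    (hj : j ∉ π) {x : ℝ} (hx0 : 0 < x) (hx1 : x ≤ 1) :
    ∃ A' : domU 𝕜 m n π, distChordal (leftMap π A) (leftMap π A') = x ∧
      distFrob A.1 A'.1 ^ 2 ≤ x ^ 2 * ((singVal A.1 i ^ 2 + singVal A.1 j ^ 2) * x ^ 2 +
        (singVal A.1 i ^ 2 - singVal A.1 j ^ 2) ^ 2 /
          (singVal A.1 i ^ 2 + singVal A.1 j ^ 2)) := by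
  obtain ⟨U, V, h⟩ := exists_isFullSVD A.1
  have hij : i ≠ j := fun e => hj (e ▸ hi)
  have hijN : (i : ℕ) ≠ j := fun e => hij (Fin.ext e)
  set a := singVal A.1 i with ha
  set b := singVal A.1 j with hb
  have ha0 : 0 ≤ a := singVal_nonneg _ _
  have hb0 : 0 ≤ b := singVal_nonneg _ _
  have hab : a ≠ b := mem_domU_iff.mp A.2 i hi j hj
  have hpos : 0 < a ^ 2 + b ^ 2 := by
    by_contra hle
    have h1 : a = 0 := by nlinarith [sq_nonneg a, sq_nonneg b]
    have h2 : b = 0 := by nlinarith [sq_nonneg a, sq_nonneg b]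
    exact hab (h1.trans h2.symm)
  set lam := 2 * a * b / (a ^ 2 + b ^ 2) with hlam
  have hlam0 : 0 ≤ lam := by positivity
  have hlam1 : lam ≤ 1 := by
    rw [hlam, div_le_one hpos]
    nlinarith [sq_nonneg (a - b)]
  have hlx : (lam * x) ^ 2 ≤ x ^ 2 :=
    pow_le_pow_left₀ (by positivity) (mul_le_of_le_one_left hx0.le hlam1) 2
  have hx2 : x ^ 2 ≤ 1 := pow_le_one₀ hx0.le hx1
  set c := √(1 - x ^ 2) with hc
  set c' := √(1 - (lam * x) ^ 2) with hc'
  have hcs : c ^ 2 + x ^ 2 = 1 := by rw [hc, Real.sq_sqrt (by linarith)]; ring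
  have hcs' : c' ^ 2 + (lam * x) ^ 2 = 1 := by rw [hc', Real.sq_sqrt (by linarith)]; ring
  -- If `i` or `j` is not a column index, then `λ = 0` and no right singular vectors are rotated.
  have hcase : ((i : ℕ) < n ∧ (j : ℕ) < n) ∨ (c' = 1 ∧ lam * x = 0) := by
    by_cases hn : (i : ℕ) < n ∧ (j : ℕ) < n
    · exact Or.inl hn
    · have hl : lam = 0 := by
        rw [not_and_or, not_lt, not_lt] at hn
        rcases hn with hn | hn
        · rw [hlam, ha, singVal_of_le _ hn]; simp
        · rw [hlam, hb, singVal_of_le _ hn]; simp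
      right
      rw [hc', hl]
      simp
  have hR : planeRot 𝕜 m i j c x ∈ Matrix.unitaryGroup (Fin m) 𝕜 :=
    planeRot_mem_unitaryGroup i.2 j.2 hijN hcs
  have hS : planeRot 𝕜 n i j c' (lam * x) ∈ Matrix.unitaryGroup (Fin n) 𝕜 := by
    rcases hcase with ⟨h1, h2⟩ | ⟨h1, h2⟩
    · exact planeRot_mem_unitaryGroup h1 h2 hijN hcs'
    · rw [h1, h2, planeRot_one_zero]
      exact one_mem _
  set R := planeRot 𝕜 m i j c x with hRdef
  set S := planeRot 𝕜 n i j c' (lam * x) with hSdef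
  obtain ⟨hsv, hsvd⟩ := isFullSVD_of_eq A.1 (mul_mem h.1 hR) (mul_mem h.2.1 hS) rfl
  set A' := U * R * sigmaHat A.1 * (V * S)ᴴ with hA'
  have hmem : A' ∈ domU 𝕜 m n π := by
    rw [mem_domU_iff]
    intro k hk l hl
    rw [hsv, hsv]
    exact mem_domU_iff.mp A.2 k hk l hl
  refine ⟨⟨A', hmem⟩, ?_, ?_⟩
  · have e := distChordal_leftMap_sq A ⟨A', hmem⟩ h hsvd
    rw [← Matrix.mul_assoc, show Uᴴ * U = 1 from Matrix.mem_unitaryGroup_iff'.mp h.1,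
      Matrix.one_mul] at e
    rw [Finset.sum_eq_single i, Finset.sum_eq_single j] at e
    · have hRij : R i j = ((-x : ℝ) : 𝕜) := by
        simp [hRdef, planeRot, rotEntry, hijN, hijN.symm]
      rw [hRij, RCLike.norm_ofReal, sq_abs, neg_sq] at e
      exact (pow_left_inj₀ (distChordal_nonneg _ _) hx0.le two_ne_zero).mp e
    · intro l hl hlj
      have h1 : (l : ℕ) ≠ j := fun e => hlj (Fin.ext e)
      have h2 : (l : ℕ) ≠ i := fun e => Finset.mem_compl.mp hl (Fin.ext e ▸ hi)
      simp [hRdef, planeRot, rotEntry, h1, h2, h2.symm]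
    · simp [hj]
    · intro k hk hki
      refine Finset.sum_eq_zero fun l hl => ?_
      have h1 : (k : ℕ) ≠ i := fun e => hki (Fin.ext e)
      have h2 : (k : ℕ) ≠ j := fun e => hj (Fin.ext e ▸ hk)
      have h3 : (k : ℕ) ≠ l := fun e => Finset.mem_compl.mp hl (Fin.ext e ▸ hk)
      simp [hRdef, planeRot, rotEntry, h1, h2, h3]
    · simp [hi]
  · have hSS : S * Sᴴ = 1 := Matrix.mem_unitaryGroup_iff.mp hS
    have hdiff : A.1 - A' = U * ((sigmaHat A.1 * S - R * sigmaHat A.1) * Sᴴ * Vᴴ) := by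
      rw [hA']
      conv_lhs => lhs; rw [h.2.2]
      rw [Matrix.sub_mul, Matrix.mul_assoc (sigmaHat A.1) S, hSS, Matrix.mul_one, Matrix.sub_mul,
        Matrix.mul_sub, Matrix.conjTranspose_mul]
      simp only [Matrix.mul_assoc]
    rw [distFrob_eq, Real.sq_sqrt (frobSq_nonneg _), hdiff,
      frobSq_isometry_mul (Matrix.mem_unitaryGroup_iff'.mp h.1),
      frobSq_mul_coisometry _
        (Matrix.mem_unitaryGroup_iff.mp (conjTranspose_mem_unitaryGroup h.2.1)),
      frobSq_mul_coisometry _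
        (Matrix.mem_unitaryGroup_iff.mp (conjTranspose_mem_unitaryGroup hS)),
      ← diagRect_singVal]
    refine (frobSq_diagRect_rot_le i.2 j.2 hijN (fun k hk => singVal_of_le A.1 hk)).trans ?_
    rw [← ha, ← hb]
    -- Both cosines lie between `1 - x ^ 2` and `1`, so their difference is of second order.
    have hb1 : ∀ y : ℝ, y ^ 2 ≤ x ^ 2 → 1 - x ^ 2 ≤ √(1 - y ^ 2) ∧ √(1 - y ^ 2) ≤ 1 := by
      intro y hy
      constructor
      · refine Real.le_sqrt_of_sq_le ?_
        nlinarith [sq_nonneg x]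
      · exact Real.sqrt_le_one.mpr (by nlinarith [sq_nonneg y])
    have hcc : (c' - c) ^ 2 ≤ (x ^ 2) ^ 2 := by
      obtain ⟨h1, h2⟩ := hb1 x le_rfl
      obtain ⟨h3, h4⟩ := hb1 (lam * x) hlx
      exact sq_le_sq' (by linarith) (by linarith)
    have hquad : (a * (lam * x) - b * x) ^ 2 + (b * (lam * x) - a * x) ^ 2 =
        x ^ 2 * ((a ^ 2 - b ^ 2) ^ 2 / (a ^ 2 + b ^ 2)) := by
      rw [hlam]
      field_simp
      ring
    nlinarith [mul_le_mul_of_nonneg_left hcc hpos.le]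

theorem distChordal_self {d : ℕ} (P : Gr 𝕜 d p) : distChordal P P = 0 := by
  have h : distChordal P P ^ 2 = 0 := by
    rw [distChordal_sq, P.frame_spec.1]
    simp [frobSq, Matrix.one_apply, apply_ite]
  exact pow_eq_zero_iff two_ne_zero |>.mp h

theorem eq_of_distFrob_eq_zero {A B : Matrix (Fin m) (Fin n) 𝕜} (h : distFrob A B = 0) :
    A = B := by
  rw [distFrob, Real.sqrt_eq_zero (by positivity)] at h
  ext i j
  rw [Finset.sum_eq_zero_iff_of_nonneg fun _ _ => by positivity] at h
  have h1 := h i (Finset.mem_univ i)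
  rw [Finset.sum_eq_zero_iff_of_nonneg fun _ _ => by positivity] at h1
  have h2 := h1 j (Finset.mem_univ j)
  rwa [sq_eq_zero_iff, norm_eq_zero, sub_eq_zero] at h2

/-- Lower bound for every distance that dominates the chordal distance. -/
theorem le_riceCond {π : Finset (Fin m)} {dGr : Gr 𝕜 π.card m → Gr 𝕜 π.card m → ℝ}
    (hd : ∀ P P', distChordal P P' ≤ dGr P P') (A : domU 𝕜 m n π) :
    maxPairCond π A.1 ≤
      riceCond (fun B B' : domU 𝕜 m n π => distFrob B.1 B'.1) dGr (leftMap π) A := by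
  refine iSup₂_le fun i hi => iSup₂_le fun j hj => ?_
  rw [Finset.mem_compl] at hj
  have hab := mem_domU_iff.mp A.2 i hi j hj
  rw [pairCond_eq (singVal_nonneg _ _) (singVal_nonneg _ _) hab]
  have hne := sq_sub_sq_ne_zero (singVal_nonneg A.1 i) (singVal_nonneg A.1 j) hab
  set a := singVal A.1 i
  set b := singVal A.1 j
  have hpos : 0 < a ^ 2 + b ^ 2 := by
    by_contra hle
    have h1 : a ^ 2 = 0 := by nlinarith [sq_nonneg a, sq_nonneg b]
    have h2 : b ^ 2 = 0 := by nlinarith [sq_nonneg a, sq_nonneg b]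
    exact hne (by rw [h1, h2, sub_self])
  refine le_iInf₂ fun ε hε => ?_
  -- `g x` bounds `‖A - A'‖_F / x` for the matrix `A'` rotated by an angle of sine `x`.
  let g : ℝ → ℝ := fun x => √((a ^ 2 + b ^ 2) * x ^ 2 + (a ^ 2 - b ^ 2) ^ 2 / (a ^ 2 + b ^ 2))
  have hg0 : g 0 = |a ^ 2 - b ^ 2| / √(a ^ 2 + b ^ 2) := by
    simp [g, Real.sqrt_div (sq_nonneg _), Real.sqrt_sq_eq_abs]
  have hg0pos : 0 < g 0 := by
    rw [hg0]
    have := abs_pos.mpr hne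
    positivity
  have hgc : Continuous g := by fun_prop
  have hlim : Filter.Tendsto (fun x => ENNReal.ofReal (1 / g x)) (𝓝[>] 0)
      (𝓝 (ENNReal.ofReal (√(a ^ 2 + b ^ 2) / |a ^ 2 - b ^ 2|))) := by
    have : √(a ^ 2 + b ^ 2) / |a ^ 2 - b ^ 2| = 1 / g 0 := by rw [hg0, one_div_div]
    rw [this]
    refine ENNReal.tendsto_ofReal (Filter.Tendsto.mono_left ?_ nhdsWithin_le_nhds)
    exact tendsto_const_nhds.div hgc.continuousAt.tendsto hg0pos.ne'
  refine le_of_tendsto hlim ?_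
  have hsmall : ∀ᶠ x in 𝓝[>] (0 : ℝ), x * g x < ε := by
    have : ContinuousAt (fun x : ℝ => x * g x) 0 := by fun_prop
    exact (this.eventually_lt_const (by simpa using hε)).filter_mono nhdsWithin_le_nhds
  filter_upwards [hsmall, Ioo_mem_nhdsGT (zero_lt_one' ℝ)] with x hxε hx
  obtain ⟨A', hch, hdist⟩ := exists_rotated A hi hj hx.1 hx.2.le
  have hgnn : 0 ≤ g x := Real.sqrt_nonneg _
  have hle : distFrob A.1 A'.1 ≤ x * g x := by
    refine le_of_sq_le_sq ?_ (mul_nonneg hx.1.le hgnn)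
    rw [mul_pow, Real.sq_sqrt (by positivity)]
    exact hdist
  have hAA' : A' ≠ A := by
    rintro rfl
    rw [distChordal_self] at hch
    exact hx.1.ne hch
  refine le_iSup₂_of_le A' ⟨hAA', hle.trans hxε.le⟩ (ENNReal.ofReal_le_ofReal ?_)
  have hd0 : 0 < distFrob A.1 A'.1 := by
    refine lt_of_le_of_ne (Real.sqrt_nonneg _) fun h => hAA' (Subtype.ext ?_)
    exact (eq_of_distFrob_eq_zero h.symm).symm
  have hgpos : 0 < g x := by
    have : 0 < (a ^ 2 - b ^ 2) ^ 2 := by positivity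
    exact Real.sqrt_pos.mpr (by positivity)
  rw [div_le_div_iff₀ hgpos hd0]
  have := hd (leftMap π A) (leftMap π A')
  rw [hch] at this
  nlinarith

/-- The first inequality gives the lower and the second the upper bound on the condition number. -/
theorem kappa_eq {π : Finset (Fin m)} {dGr : Gr 𝕜 π.card m → Gr 𝕜 π.card m → ℝ}
    (h1 : ∀ P P', distChordal P P' ≤ dGr P P')
    (h2 : ∀ P P', dGr P P' * √(1 - distChordal P P' ^ 2) ≤ distChordal P P')
    (A : Matrix (Fin m) (Fin n) 𝕜) : kappa π dGr A = maxPairCond π A := by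
  unfold kappa
  split_ifs with h
  · exact le_antisymm (riceCond_le h2 ⟨A, h⟩) (le_riceCond h1 ⟨A, h⟩)
  · exact (maxPairCond_of_notMem h).symm

end SingularSubspace

end

open SingularSubspace in
theorem theorem1 {𝕜 : Type*} [RCLike 𝕜] {m n : ℕ} (A : Matrix (Fin m) (Fin n) 𝕜)
    (π : Finset (Fin m)) :
    SingularSubspace.kappa π SingularSubspace.distChordal A
        = SingularSubspace.maxPairCond π A ∧
      SingularSubspace.kappa π SingularSubspace.distGrassmann A
        = SingularSubspace.maxPairCond π A ∧
      SingularSubspace.kappa π SingularSubspace.distProcrustes A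
        = SingularSubspace.maxPairCond π A := by
  have hmono : ∀ {x y z : ℝ}, x ≤ y → y * √(1 - z ^ 2) ≤ z → x * √(1 - z ^ 2) ≤ z :=
    fun hxy h => (mul_le_mul_of_nonneg_right hxy (Real.sqrt_nonneg _)).trans h
  refine ⟨kappa_eq (fun _ _ => le_rfl) (fun P P' => ?_) A,
    kappa_eq (fun P P' => ?_) distGrassmann_mul_le A,
    kappa_eq distChordal_le_distProcrustes (fun P P' => ?_) A⟩
  · exact hmono ((distChordal_le_distProcrustes P P').trans
      (distProcrustes_le_distGrassmann P P')) (distGrassmann_mul_le P P')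
  · exact (distChordal_le_distProcrustes P P').trans (distProcrustes_le_distGrassmann P P')
  · exact hmono (distProcrustes_le_distGrassmann P P') (distGrassmann_mul_le P P')
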